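/- Let $p$ be an odd prime, $m>2$ an integer, $r=p^m$, and let $\mathrm{Tr}:\mathbb{F}_r\to\mathbb{F}_p$ be the trace. Let $\eta$ be the quadratic character of $\mathbb{F}_p$ and let $m_p=m \bmod p$, regarded as an element of $\mathbb{F}_p$. Put $$D=\{x\in\mathbb{F}_r : \mathrm{Tr}(x)=1,\ \mathrm{Tr}(x^2)=0\},\qquad C_D=\{(\mathrm{Tr}(ax))_{x\in D} : a\in\mathbb{F}_r\},$$ a linear code over $\mathbb{F}_p$ of length $\#D$. The Hamming weight distribution of $C_D$ is given by the following tables of pairs (weight : frequency). That is, for every $w$ the number of codewords of weight $w$ is the sum of the frequencies of the rows whose weight equals $w$ (so rows whose weights coincide are added, a row may have frequency $0$, and no other weight occurs). (1) If $2\mid m$ and $m_p=0$, with $\varepsilon=(-1)^{\frac{(p-1)m}{4}}$: - $0$ : $1$ - $p^{m-2}$ : $p-1$ - $(p-1)p^{m-3}$ : $p^{m-1}-p$ - $(p-1)\big(p^{m-3}+\varepsilon p^{\frac{m-4}{2}}\big)$ : $(p-1)p^{m-2}$ - $(p-1)p^{m-3}-\varepsilon p^{\frac{m-4}{2}}$ :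 $(p-1)^2p^{m-2}$ (2) If $2\mid m$ and $m_p\neq 0$, with $\varepsilon=(-1)^{\frac{(p-1)m}{4}}$, the length is $n=\#D=p^{m-2}-\varepsilon p^{\frac{m-2}{2}}$, and the table is: - $0$ : $1$ - $(p-1)p^{m-3}$ : $p^{m-2}-1$ - $(p-1)\big(p^{m-3}-\varepsilon p^{\frac{m-4}{2}}\big)$ : $\frac{p-1}{2}\big(p^{m-1}+\varepsilon p^{\frac m2}\big)$ - $n$ : $p-1$ - $n-p^{m-3}$ : $(p-1)(p^{m-2}-1)$ - $(p-1)p^{m-3}-\varepsilon p^{\frac{m-4}{2}}$ : $(p-1)n$ - $(p-1)p^{m-3}-(p+1)\varepsilon p^{\frac{m-4}{2}}$ : $\frac12(p-1)(p-2)n$ (3) If $2\nmid m$ and $m_p=0$: - $0$ : $1$ - $p^{m-2}$ : $p-1$ - $(p-1)p^{m-3}$ : $2p^{m-1}-p^{m-2}-p$ - $(p-1)p^{m-3}-p^{\frac{m-3}{2}}$ : $\frac12(p-1)^2p^{m-2}$ - $(p-1)p^{m-3}+p^{\frac{m-3}{2}}$ : $\frac12(p-1)^2p^{m-2}$ (4)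 If $2\nmid m$ and $m_p\neq0$, with $\varepsilon=(-1)^{\frac{(p-1)(m+1)}{4}}$ and $\delta=(-1)^{\frac{(p-1)(m-1)}{4}}$, the length is $n=\#D=p^{m-2}-\eta(-m_p)\,\varepsilon\, p^{\frac{m-3}{2}}$, and the table is: - $0$ : $1$ - $(p-1)p^{m-3}$ : $n+\eta(-m_p)\,\varepsilon\, p^{\frac{m-1}{2}}-1$ - $n$ : $p-1$ - $n-p^{m-3}$ : $(p-1)\big(2n+\eta(-m_p)\,\varepsilon\, p^{\frac{m-1}{2}}-1\big)$ - $n-p^{m-3}-\delta p^{\frac{m-3}{2}}$ : $f_4$ - $n-p^{m-3}+\delta p^{\frac{m-3}{2}}$ : $f_5$ where $f_4=\frac12(p-1)(p-2)n$ and $f_5=\frac12(p-1)pn$ if $\eta(m_p)=1$, and $f_4=\frac12(p-1)pn$ and $f_5=\frac12(p-1)(p-2)n$ if $\eta(m_p)=-1$. -/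

import Mathlib

/-- The defining set `D = {x ∈ F : Tr(x) = 1, Tr(x²) = 0}`, where `Tr` is the absolute trace
of the finite field `F` of characteristic `p`. -/
noncomputable def definingSet (p : ℕ) [Fact p.Prime] (F : Type*) [Field F] [Fintype F]
    [Algebra (ZMod p) F] : Finset F :=
  Finset.univ.filter fun x =>
    Algebra.trace (ZMod p) F x = 1 ∧ Algebra.trace (ZMod p) F (x ^ 2) = 0

/-- The linear code `C_D = {(Tr(a x))_{x ∈ D} : a ∈ F}` with defining set `D ⊆ F`. Its coordinates
are indexed by the elements of `D`, so its length is `#D`. -/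
noncomputable def traceCode (p : ℕ) [Fact p.Prime] {F : Type*} [Field F]
    [Algebra (ZMod p) F] (D : Finset F) : Submodule (ZMod p) (D → ZMod p) :=
  LinearMap.range (LinearMap.pi fun x : D =>
    (Algebra.trace (ZMod p) F).comp (LinearMap.mulRight (ZMod p) (x : F)))

/-- The codewords of `traceCode p D` are exactly the vectors `(Tr(a x))_{x ∈ D}`. -/
theorem mem_traceCode (p : ℕ) [Fact p.Prime] {F : Type*} [Field F]
    [Algebra (ZMod p) F] (D : Finset F) (c : D → ZMod p) :
    c ∈ traceCode p D ↔ ∃ a : F, c = fun x : D => Algebra.trace (ZMod p) F (a * (x : F)) := by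
  constructor
  · rintro ⟨a, rfl⟩
    exact ⟨a, rfl⟩
  · rintro ⟨a, rfl⟩
    exact ⟨a, rfl⟩

/-- The (Hamming) weight distribution of the code `C` is given by the table `T`, a list of rows
(weight, frequency): for every `w`, the number of codewords of weight `w` is the sum of the
frequencies of the rows whose weight equals `w`. Thus rows with the same weight are added up, and a
weight that is in no row does not occur. -/
def HasWeightDistribution {K : Type*} [Field K] [DecidableEq K] {ι : Type*} [Fintype ι]
    (C : Submodule K (ι → K)) (T : List (ℚ × ℚ)) : Prop :=
  ∀ w : ℚ, (({c : ι → K | c ∈ C ∧ (hammingNorm c : ℚ) = w}.ncard : ℕ) : ℚ) =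
    ((T.filter fun row => row.1 = w).map fun row => row.2).sum

/-! Write `K` for the prime field, `L` for the big field, q = #K and M = Tr(1). The weight of the
word of a is #D minus the number of x in D with Tr(ax) = 0. If a = t is a nonzero element of K, then
Tr(tx) = t on D and the weight is #D. If a is not in K, then 1 and a are linearly independent over
K, and the weight depends only on T = Tr(a) and A = Tr(a²).

To see this, count the (z, w) in K² with Tr(x²) + 2(Tr(x) - 1)z + 2Tr(ax)w = 0. There are q of them
unless Tr(x) = 1 and Tr(ax) = 0, so summing over x isolates the section of D; these point counts
play the role of additive characters. Translating x by z + wa turns the same total into a sum over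
(z, w) of the number of representations of Mz² + 2Tzw + Aw² + 2z by the form Tr(x²)
(`sum_sum_traceFormCount`). That number is known once the form is diagonalised
(`diagonalCount_formulas`), because the discriminant of a degree n extension has quadratic character
(-1)^(n-1) (`ratQuadraticChar_discr`). What remains are classical sums over plane conics.

The distribution is obtained by evaluating ∑ g(weight of a) for an arbitrary function g
(`sum_comp_traceWeight`): the number of a with given (T, A) comes from the same method, and the
elements of K are corrected for separately. Since no nonzero a has weight 0, distinct a give
distinct words, so these sums count codewords (`hasWeightDistribution_traceCode`). Coinciding
weights need no special care, because g is arbitrary. -/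

/-- The quadratic character of a finite field with values in `ℚ`. -/
noncomputable def ratQuadraticChar (K : Type*) [Field K] [Fintype K] [DecidableEq K] :
    MulChar K ℚ :=
  (quadraticChar K).ringHomComp (Int.castRingHom ℚ)

/-! ### Sums of the quadratic character over quadratic polynomials -/

section CharacterSums

open Finset

variable {K : Type*} [Field K] [Fintype K]

theorem sum_comp_affine {b : K} (hb : b ≠ 0) (a : K) (f : K → ℚ) :
    ∑ z, f (a + b * z) = ∑ z, f z :=
  ((Equiv.mulLeft₀ b hb).trans (Equiv.addLeft a)).sum_comp f

theorem sum_comp_complete_square {a : K} (ha : a ≠ 0) (b c : K) (f : K → ℚ) :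
    ∑ w, f (a * w ^ 2 + 2 * b * w + c) = ∑ w, f (a⁻¹ * (w ^ 2 - (b ^ 2 - a * c))) := by
  rw [← sum_comp_affine ha b (fun w => f (a⁻¹ * (w ^ 2 - (b ^ 2 - a * c))))]
  refine sum_congr rfl fun w _ => ?_
  congr 1
  field_simp
  ring

variable [DecidableEq K]

local notation "χ" => ratQuadraticChar K

theorem ratQuadraticChar_apply (a : K) :
    χ a = ((quadraticChar K a : ℤ) : ℚ) := rfl

theorem ratQuadraticChar_zero : χ 0 = 0 := by
  simp [ratQuadraticChar_apply]

theorem ratQuadraticChar_eq_one_or_neg_one {a : K} (ha : a ≠ 0) : χ a = 1 ∨ χ a = -1 := by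
  rcases quadraticChar_dichotomy ha with h | h <;> simp [ratQuadraticChar_apply, h]

theorem ratQuadraticChar_mul_self (a : K) : χ a * χ a = if a = 0 then 0 else 1 := by
  split_ifs with h
  · simp [h, ratQuadraticChar_zero]
  · rcases ratQuadraticChar_eq_one_or_neg_one h with h | h <;> simp [h]

theorem ratQuadraticChar_mul_mul_self {a b : K} (hb : b ≠ 0) : χ (a * (b * b)) = χ a := by
  rw [map_mul, map_mul, ratQuadraticChar_mul_self, if_neg hb, mul_one]

theorem ratQuadraticChar_inv (a : K) : χ a⁻¹ = χ a := by
  by_cases ha : a = 0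
  · simp [ha]
  · rw [← ratQuadraticChar_mul_mul_self (a := a⁻¹) ha, inv_mul_cancel_left₀ ha]

theorem sum_ratQuadraticChar (h2 : ringChar K ≠ 2) : ∑ a, χ a = 0 := by
  have := quadraticChar_sum_zero h2
  simp only [ratQuadraticChar_apply]
  exact_mod_cast this

/-- For z ≠ 0 the argument is z²(a + b/z), so inverting z leaves a complete sum of χ over an affine
line, which vanishes, minus one spurious term. -/
theorem sum_ratQuadraticChar_linear_mul (h2 : ringChar K ≠ 2) (a : K) {b : K} (hb : b ≠ 0) :
    ∑ z, χ (a * z ^ 2 + b * z) = -χ a := by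
  -- Since 0⁻¹ = 0, the first term on the right at z = 0 is χ(a), which the correction removes.
  have h : ∀ z : K, χ (a * z ^ 2 + b * z) = χ (a + b * z⁻¹) - if z = 0 then χ a else 0 := by
    intro z
    split_ifs with hz
    · simp [hz, ratQuadraticChar_zero]
    · rw [sub_zero, ← ratQuadraticChar_mul_mul_self (a := a + b * z⁻¹) hz]
      congr 1
      field_simp
  simp only [h, sum_sub_distrib, sum_ite_eq', mem_univ, if_true]
  have hinv := Equiv.sum_comp (Equiv.inv K) (fun z => χ (a + b * z))
  simp only [Equiv.inv_apply] at hinv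
  rw [hinv, sum_comp_affine hb a χ,
    sum_ratQuadraticChar h2, zero_sub]

theorem sum_ite_sq_eq (h2 : ringChar K ≠ 2) (d : K) :
    ∑ w : K, (if w ^ 2 = d then 1 else 0 : ℚ) = 1 + χ d := by
  have h := quadraticChar_card_sqrts h2 d
  rw [sum_boole, ratQuadraticChar_apply, add_comm]
  have h' : ((#{w : K | w ^ 2 = d} : ℕ) : ℤ) = quadraticChar K d + 1 := by
    rw [← h]
    congr 2
    ext
    simp
  exact_mod_cast h'

theorem sum_comp_sq (h2 : ringChar K ≠ 2) (f : K → ℚ) :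
    ∑ w : K, f (w ^ 2) = ∑ s, (1 + χ s) * f s := by
  calc ∑ w : K, f (w ^ 2) = ∑ w : K, ∑ s, (if w ^ 2 = s then 1 else 0 : ℚ) * f s := by simp
    _ = _ := by
      rw [sum_comm]
      simp only [← sum_mul, sum_ite_sq_eq h2]

theorem sum_ratQuadraticChar_sq_sub (h2 : ringChar K ≠ 2) (d : K) :
    ∑ w : K, χ (w ^ 2 - d) = Fintype.card K * (if d = 0 then 1 else 0) - 1 := by
  split_ifs with hd
  · subst hd
    have h : ∀ w : K, χ (w ^ 2 - 0) = 1 - if w = 0 then 1 else 0 := by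
      intro w
      rw [sub_zero, sq, map_mul, ratQuadraticChar_mul_self]
      split_ifs <;> simp
    simp only [h]
    simp
  · rw [sum_comp_sq h2 (fun s => χ (s - d))]
    simp only [add_mul, one_mul, sum_add_distrib, ← map_mul]
    have h1 : ∑ s : K, χ (s - d) = 0 := by
      rw [← sum_ratQuadraticChar h2]
      exact (Equiv.subRight d).sum_comp χ
    have h3 : ∀ s : K, s * (s - d) = 1 * s ^ 2 + (-d) * s := fun s => by ring
    simp only [h1, h3]
    rw [sum_ratQuadraticChar_linear_mul h2 1 (neg_ne_zero.2 hd), map_one]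
    ring

theorem sum_ratQuadraticChar_quadratic (h2 : ringChar K ≠ 2) {a : K} (ha : a ≠ 0) (b c : K) :
    ∑ w, χ (a * w ^ 2 + 2 * b * w + c) =
      χ a * (Fintype.card K * (if b ^ 2 - a * c = 0 then 1 else 0) - 1) := by
  rw [sum_comp_complete_square ha b c χ, ← sum_ratQuadraticChar_sq_sub h2]
  simp only [map_mul, mul_sum, ratQuadraticChar_inv]

theorem sum_ite_quadratic_eq_zero (h2 : ringChar K ≠ 2) {a : K} (ha : a ≠ 0) (b c : K) :
    ∑ w, (if a * w ^ 2 + 2 * b * w + c = 0 then 1 else 0 : ℚ) = 1 + χ (b ^ 2 - a * c) := by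
  rw [sum_comp_complete_square ha b c (fun s => if s = 0 then 1 else 0), ← sum_ite_sq_eq h2]
  simp [ha, sub_eq_zero]

theorem sum_ite_affine_eq_zero {b : K} (hb : b ≠ 0) (a : K) :
    ∑ w, (if a + b * w = 0 then 1 else 0 : ℚ) = 1 := by
  rw [sum_comp_affine hb a (fun s => if s = 0 then 1 else 0)]
  simp

end CharacterSums

/-! ### Representation numbers of diagonal quadratic forms -/

section DiagonalForms

open Finset

variable {K : Type*} [Field K] [Fintype K] [DecidableEq K]

local notation "χ" => ratQuadraticChar K

/-- The number of representations of `t` by the diagonal quadratic form `∑ aᵢ xᵢ²`. -/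
def diagonalCount {n : ℕ} (a : Fin n → K) (t : K) : ℚ :=
  ∑ x : Fin n → K, if ∑ i, a i * x i ^ 2 = t then 1 else 0

theorem diagonalCount_succ {n : ℕ} (a : Fin (n + 1) → K) (t : K) :
    diagonalCount a t = ∑ s : K, diagonalCount (fun i => a i.succ) (t - a 0 * s ^ 2) := by
  unfold diagonalCount
  rw [← Fintype.sum_prod_type', ← (Fin.consEquiv fun _ : Fin (n + 1) => K).sum_comp]
  refine sum_congr rfl fun x _ => ?_
  simp [Fin.consEquiv, Fin.sum_univ_succ, eq_sub_iff_add_eq']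

/-- Induction by splitting off one variable, alternating parity: summing the indicator of t = 0 over
the new variable counts square roots and produces χ(t), while summing χ over it is a quadratic
character sum and restores the indicator. The factor q on the left avoids a negative exponent for
the empty form. -/
theorem diagonalCount_formulas (h2 : ringChar K ≠ 2) (j : ℕ) :
    (∀ (a : Fin (2 * j) → K) (t : K), (∀ i, a i ≠ 0) →
      Fintype.card K * diagonalCount a t = Fintype.card K ^ (2 * j) +
        χ ((-1) ^ j * ∏ i, a i) * Fintype.card K ^ j *
          (Fintype.card K * (if t = 0 then 1 else 0) - 1)) ∧
    (∀ (a : Fin (2 * j + 1) → K) (t : K), (∀ i, a i ≠ 0) →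
      Fintype.card K * diagonalCount a t = Fintype.card K ^ (2 * j + 1) +
        χ ((-1) ^ j * (∏ i, a i) * t) * Fintype.card K ^ (j + 1)) := by
  have odd_of_even : ∀ j : ℕ, (∀ (a : Fin (2 * j) → K) (t : K), (∀ i, a i ≠ 0) →
      Fintype.card K * diagonalCount a t = Fintype.card K ^ (2 * j) +
        χ ((-1) ^ j * ∏ i, a i) * Fintype.card K ^ j *
          (Fintype.card K * (if t = 0 then 1 else 0) - 1)) →
      (∀ (a : Fin (2 * j + 1) → K) (t : K), (∀ i, a i ≠ 0) →
      Fintype.card K * diagonalCount a t = Fintype.card K ^ (2 * j + 1) +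
        χ ((-1) ^ j * (∏ i, a i) * t) * Fintype.card K ^ (j + 1)) := by
    intro j ih a t ha
    rw [diagonalCount_succ, mul_sum, sum_congr rfl fun s _ => ih _ _ fun i => ha _]
    have h : ∑ s : K, (if t - a 0 * s ^ 2 = 0 then 1 else 0 : ℚ) = 1 + χ (a 0 * t) := by
      rw [← ratQuadraticChar_mul_mul_self (a := a 0 * t) (inv_ne_zero (ha 0)), ← sum_ite_sq_eq h2]
      refine sum_congr rfl fun s _ => ?_
      congr 1
      have := ha 0
      rw [sub_eq_zero, eq_iff_iff]
      field_simp
      exact eq_comm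
    simp only [sum_add_distrib, ← mul_sum, sum_sub_distrib, h]
    have hχ : χ ((-1) ^ j * (∏ i, a i) * t) = χ ((-1) ^ j * ∏ i : Fin (2 * j), a i.succ) *
        χ (a 0 * t) := by
      rw [← map_mul, Fin.prod_univ_succ]
      congr 1
      ring
    rw [hχ]
    simp only [sum_const, card_univ, nsmul_eq_mul]
    ring
  induction j with
  | zero =>
    have h0 : ∀ (a : Fin (2 * 0) → K) (t : K), (∀ i, a i ≠ 0) →
      Fintype.card K * diagonalCount a t = Fintype.card K ^ (2 * 0) +
        χ ((-1) ^ 0 * ∏ i, a i) * Fintype.card K ^ 0 *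
          (Fintype.card K * (if t = 0 then 1 else 0) - 1) := by
      intro a t _
      have : diagonalCount a t = if t = 0 then 1 else 0 := by
        have : Subsingleton (Fin (2 * 0) → K) := inferInstanceAs (Subsingleton (Fin 0 → K))
        rw [diagonalCount, Fintype.sum_eq_single 0 fun x hx => absurd (Subsingleton.elim x 0) hx]
        simp [eq_comm]
      rw [this]
      simp
    exact ⟨h0, odd_of_even 0 h0⟩
  | succ j ih =>
    have h1 : ∀ (a : Fin (2 * (j + 1)) → K) (t : K), (∀ i, a i ≠ 0) →
      Fintype.card K * diagonalCount a t = Fintype.card K ^ (2 * (j + 1)) +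
        χ ((-1) ^ (j + 1) * ∏ i, a i) * Fintype.card K ^ (j + 1) *
          (Fintype.card K * (if t = 0 then 1 else 0) - 1) := by
      intro a t ha
      rw [diagonalCount_succ (n := 2 * j + 1), mul_sum,
        sum_congr rfl fun s _ => ih.2 _ _ fun i => ha _]
      have h := sum_ratQuadraticChar_quadratic h2 (neg_ne_zero.2 (ha 0)) 0 t
      have h3 : ∀ s : K, t - a 0 * s ^ 2 = -a 0 * s ^ 2 + 2 * 0 * s + t := fun s => by ring
      have hχ : χ ((-1) ^ (j + 1) * ∏ i, a i) =
          χ ((-1) ^ j * ∏ i : Fin (2 * j + 1), a i.succ) * χ (-a 0) := by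
        rw [← map_mul]
        congr 1
        refine (congrArg _ (Fin.prod_univ_succ (n := 2 * j + 1) a)).trans ?_
        ring
      have h4 : (0 ^ 2 - -a 0 * t = 0) ↔ t = 0 := by simp [ha 0]
      simp only [h4] at h
      simp only [sum_add_distrib, map_mul _ (_ * _ : K), ← sum_mul, ← mul_sum]
      rw [hχ, map_mul]
      simp only [h3, h, sum_const, card_univ, nsmul_eq_mul]
      ring
    exact ⟨h1, odd_of_even _ h1⟩

end DiagonalForms

/-! ### Discriminant and representation numbers of the trace form -/

section TraceForm

open Finset

variable {K L : Type*} [Field K] [Fintype K] [DecidableEq K] [Field L] [Fintype L] [Algebra K L]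

/-- The quadratic character of the discriminant of an extension of finite fields. -/
theorem ratQuadraticChar_discr (h2 : ringChar K ≠ 2) {k : ℕ} (b : Module.Basis (Fin (k + 1)) K L) :
    ratQuadraticChar K (Algebra.discr K b) = (-1) ^ k := by
  have hfin : Module.finrank K L = k + 1 := by simp [Module.finrank_eq_card_basis b]
  set q := Fintype.card K with hq
  have hcard : Fintype.card L = q ^ (k + 1) := by rw [Module.card_eq_pow_finrank (K := K), hfin]
  -- The matrix of conjugates of the basis: as the trace is the sum of the conjugates, the
  -- discriminant is det(M)².
  let M : Matrix (Fin (k + 1)) (Fin (k + 1)) L := Matrix.of fun i j => b j ^ q ^ (i : ℕ)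
  have hM : M.transpose * M = (Algebra.traceMatrix K b).map (algebraMap K L) := by
    ext i j
    rw [Matrix.mul_apply, Matrix.map_apply, Algebra.traceMatrix_apply, Algebra.traceForm_apply,
      FiniteField.algebraMap_trace_eq_sum_pow, hfin, Finset.sum_range]
    refine sum_congr rfl fun l _ => ?_
    simp [M, mul_pow, hq]
  have hdet : M.det * M.det = algebraMap K L (Algebra.discr K b) := by
    rw [Algebra.discr_def, RingHom.map_det, RingHom.mapMatrix_apply, ← hM, Matrix.det_mul,
      Matrix.det_transpose]
  -- Frobenius permutes the rows cyclically, the last row wrapping round because q^(k+1) is the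
  -- order of L. A (k+1)-cycle has sign (-1)^k, whence det(M)^q = (-1)^k det(M).
  have hrot : M.submatrix (finRotate (k + 1)) id =
      (FiniteField.frobeniusAlgHom K L).toRingHom.mapMatrix M := by
    ext i j
    have : (FiniteField.frobeniusAlgHom K L).toRingHom (M i j) = M i j ^ q := rfl
    rw [RingHom.mapMatrix_apply, Matrix.map_apply, this]
    simp only [M, Matrix.submatrix_apply, Matrix.of_apply, id, ← pow_mul, ← pow_succ]
    rcases eq_or_ne i (Fin.last k) with rfl | hi
    · have := FiniteField.pow_card (b j)
      rw [hcard] at this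
      simp [this]
    · rw [coe_finRotate_of_ne_last hi]
  have hfrob : M.det ^ q = (-1) ^ k * M.det := by
    have h := Matrix.det_permute (finRotate (k + 1)) M
    rw [hrot, ← RingHom.map_det] at h
    have h' : (FiniteField.frobeniusAlgHom K L).toRingHom M.det = M.det ^ q := rfl
    rw [← h', h, sign_finRotate]
    simp
  have hdiscr : Algebra.discr K b ≠ 0 := Algebra.discr_not_zero_of_basis K b
  have hd : M.det ≠ 0 := by
    intro h
    rw [h, mul_zero, eq_comm, map_eq_zero] at hdet
    exact hdiscr hdet
  have hodd : q % 2 = 1 := FiniteField.odd_card_of_char_ne_two h2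
  have hpow : M.det ^ (q - 1) = (-1) ^ k := by
    refine mul_right_cancel₀ hd ?_
    rw [← hfrob, ← pow_succ]
    congr 1
    omega
  have hchar := quadraticChar_eq_pow_of_char_ne_two' h2 (Algebra.discr K b)
  -- Euler's criterion: the character is disc^((q-1)/2) = det(M)^(q-1) = (-1)^k.
  have hL : algebraMap K L ((quadraticChar K (Algebra.discr K b) : ℤ) : K) =
      algebraMap K L ((-1) ^ k) := by
    rw [hchar, map_pow, ← hdet, ← sq, ← pow_mul, map_pow, map_neg, map_one, ← hpow]
    congr 1
    omega
  have hK := (algebraMap K L).injective hL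
  have hne : (1 : K) ≠ -1 := (Ring.neg_one_ne_one_of_char_ne_two h2).symm
  rw [ratQuadraticChar_apply]
  rcases Nat.even_or_odd k with hk | hk <;>
    rcases quadraticChar_dichotomy hdiscr with h | h <;>
    rw [h, hk.neg_one_pow] at hK <;> rw [h, hk.neg_one_pow] <;> push_cast at hK ⊢
  all_goals first | rfl | exact absurd hK hne | exact absurd hK.symm hne

/-- The number of representations of `t` by the trace form `Tr(x ^ 2)`. -/
noncomputable def traceFormCount (L : Type*) [Field L] [Fintype L] [Algebra K L] (t : K) : ℚ :=
  ∑ x : L, if Algebra.trace K L (x ^ 2) = t then 1 else 0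

/-- In an orthogonal basis for the trace form the Gram matrix is diagonal, so the product of the
coefficients is the discriminant of that basis. -/
theorem exists_diagonalCount_eq_traceFormCount (h2 : ringChar K ≠ 2) {n : ℕ}
    (hn : Module.finrank K L = n) :
    ∃ a : Fin n → K, (∀ i, a i ≠ 0) ∧ ratQuadraticChar K (∏ i, a i) = (-1) ^ (n - 1) ∧
      ∀ t, traceFormCount L t = diagonalCount a t := by
  obtain ⟨k, rfl⟩ : ∃ k, n = k + 1 :=
    Nat.exists_eq_succ_of_ne_zero (hn ▸ (Module.finrank_pos (R := K) (M := L)).ne')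
  have : Invertible (2 : K) := invertibleOfNonzero (Ring.two_ne_zero h2)
  obtain ⟨v, hv⟩ := LinearMap.BilinForm.exists_orthogonal_basis
    (B := Algebra.traceForm K L) ⟨fun x y => by
      rw [Algebra.traceForm_apply, Algebra.traceForm_apply, mul_comm]; rfl⟩
  let b : Module.Basis (Fin (k + 1)) K L := v.reindex (finCongr hn)
  have hb : ∀ i j, i ≠ j → Algebra.trace K L (b i * b j) = 0 := by
    intro i j hij
    have := hv (i := (finCongr hn).symm i) (j := (finCongr hn).symm j) (by simpa using hij)
    simpa [b, Algebra.traceForm_apply] using this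
  have hdiag : Algebra.traceMatrix K b =
      Matrix.diagonal fun i => Algebra.trace K L (b i * b i) := by
    ext i j
    rw [Algebra.traceMatrix_apply, Algebra.traceForm_apply, Matrix.diagonal_apply]
    split_ifs with h
    · rw [h]
    · exact hb i j h
  have hprod : ∏ i, Algebra.trace K L (b i * b i) = Algebra.discr K b := by
    rw [Algebra.discr_def, hdiag, Matrix.det_diagonal]
  refine ⟨fun i => Algebra.trace K L (b i * b i), fun i => ?_, ?_, fun t => ?_⟩
  · exact prod_ne_zero_iff.1 (hprod ▸ Algebra.discr_not_zero_of_basis K b) i (mem_univ i)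
  · rw [hprod, ratQuadraticChar_discr h2, Nat.add_sub_cancel]
  · rw [traceFormCount, diagonalCount, ← b.equivFun.symm.toEquiv.sum_comp]
    refine sum_congr rfl fun x _ => ?_
    congr 2
    simp only [LinearEquiv.coe_toEquiv, Module.Basis.equivFun_symm_apply]
    rw [sq, sum_mul_sum, map_sum]
    refine sum_congr rfl fun i _ => ?_
    rw [map_sum, sum_eq_single i]
    · rw [smul_mul_smul_comm, map_smul, smul_eq_mul]
      ring
    · intro j _ hj
      rw [smul_mul_smul_comm, map_smul, hb i j hj.symm, smul_zero]
    · simp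

theorem traceFormCount_of_even (h2 : ringChar K ≠ 2) {k : ℕ}
    (hk : Module.finrank K L = 2 * k + 4) (t : K) :
    traceFormCount L t = (Fintype.card K : ℚ) ^ (2 * k + 3) +
      -ratQuadraticChar K (-1) ^ k * Fintype.card K ^ (k + 1) *
        (Fintype.card K * (if t = 0 then 1 else 0) - 1) := by
  obtain ⟨a, ha, hχ, h⟩ := exists_diagonalCount_eq_traceFormCount (L := L) h2
    (show Module.finrank K L = 2 * (k + 2) from hk)
  have hd := (diagonalCount_formulas h2 (k + 2)).1 a t ha
  have hq : (Fintype.card K : ℚ) ≠ 0 := by simp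
  rw [h, ← mul_right_inj' hq, hd]
  have h1 : ratQuadraticChar K (-1) * ratQuadraticChar K (-1) = 1 := by
    rw [ratQuadraticChar_mul_self, if_neg (by simp)]
  have h3 : ratQuadraticChar K ((-1) ^ (k + 2) * ∏ i, a i) = -ratQuadraticChar K (-1) ^ k := by
    rw [map_mul, map_pow, hχ, pow_add, sq, h1, Odd.neg_one_pow ⟨k + 1, by omega⟩]
    ring
  rw [h3]
  ring

theorem traceFormCount_of_odd (h2 : ringChar K ≠ 2) {k : ℕ}
    (hk : Module.finrank K L = 2 * k + 3) (t : K) :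
    traceFormCount L t = (Fintype.card K : ℚ) ^ (2 * k + 2) +
      ratQuadraticChar K (-1) ^ (k + 1) * Fintype.card K ^ (k + 1) * ratQuadraticChar K t := by
  obtain ⟨a, ha, hχ, h⟩ := exists_diagonalCount_eq_traceFormCount (L := L) h2
    (show Module.finrank K L = 2 * (k + 1) + 1 from hk)
  have hd := (diagonalCount_formulas h2 (k + 1)).2 a t ha
  have hq : (Fintype.card K : ℚ) ≠ 0 := by simp
  rw [h, ← mul_right_inj' hq, hd]
  have h3 : ratQuadraticChar K ((-1) ^ (k + 1) * (∏ i, a i) * t) =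
      ratQuadraticChar K (-1) ^ (k + 1) * ratQuadraticChar K t := by
    rw [map_mul, map_mul, map_pow, hχ, Even.neg_one_pow ⟨k + 1, by omega⟩, mul_one]
  rw [h3]
  ring

end TraceForm

/-! ### Reducing trace conditions to sums of representation numbers -/

section TraceCounts

open Finset

variable {K L : Type*} [Field K] [Field L] [Algebra K L]

theorem algebraMap_add_mul_eq_zero_iff {a : L} (ha : a ∉ Set.range (algebraMap K L)) (z w : K) :
    algebraMap K L z + algebraMap K L w * a = 0 ↔ z = 0 ∧ w = 0 := by
  constructor
  · intro h
    by_cases hw : w = 0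
    · simpa [hw] using h
    · refine absurd ⟨-z / w, ?_⟩ ha
      have : algebraMap K L w ≠ 0 := by simpa using hw
      rw [map_div₀, map_neg, div_eq_iff this]
      linear_combination -h
  · rintro ⟨rfl, rfl⟩
    simp

theorem trace_mul_add_algebraMap (z w : K) (a x : L) :
    Algebra.trace K L ((algebraMap K L z + algebraMap K L w * a) * x) =
      z * Algebra.trace K L x + w * Algebra.trace K L (a * x) := by
  rw [add_mul, mul_assoc, ← Algebra.smul_def, ← Algebra.smul_def, map_add, map_smul, map_smul,
    smul_eq_mul, smul_eq_mul]

theorem trace_add_sq (x u : L) :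
    Algebra.trace K L ((x + u) ^ 2) =
      Algebra.trace K L (x ^ 2) + 2 * Algebra.trace K L (u * x) + Algebra.trace K L (u ^ 2) := by
  have h : (x + u) ^ 2 = x ^ 2 + (u * x + u * x) + u ^ 2 := by ring
  rw [h, map_add, map_add, map_add, two_mul]

theorem trace_add_algebraMap_sq (z w : K) (a : L) :
    Algebra.trace K L ((algebraMap K L z + algebraMap K L w * a) ^ 2) =
      Algebra.trace K L 1 * z ^ 2 + 2 * Algebra.trace K L a * z * w +
        Algebra.trace K L (a ^ 2) * w ^ 2 := by
  have h := trace_mul_add_algebraMap z w a 1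
  have h' := trace_mul_add_algebraMap z w a a
  rw [mul_one, mul_one] at h
  rw [sq, trace_mul_add_algebraMap, h, mul_comm a, h', sq a]
  ring

variable [Fintype K] [DecidableEq K] [Fintype L]

theorem sum_ite_affine_eq_zero' (e f : K) :
    ∑ z : K, (if e + f * z = 0 then 1 else 0 : ℚ) =
      1 + (if f = 0 then 1 else 0) * (Fintype.card K * (if e = 0 then 1 else 0) - 1) := by
  by_cases hf : f = 0
  · simp [hf]
  · rw [sum_ite_affine_eq_zero hf]
    simp [hf]

/-- The detection device: the count is that of a line, namely q, unless both slopes vanish, in which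
case it is q² or 0 according to e. -/
theorem sum_sum_ite_affine_eq_zero (e f g : K) :
    ∑ z : K, ∑ w : K, (if e + f * z + g * w = 0 then 1 else 0 : ℚ) =
      Fintype.card K + (if f = 0 ∧ g = 0 then 1 else 0) *
        (Fintype.card K ^ 2 * (if e = 0 then 1 else 0) - Fintype.card K) := by
  simp only [sum_ite_affine_eq_zero' _ g]
  by_cases hg : g = 0
  · simp only [hg, if_true, and_true, one_mul, add_sub_cancel, ← mul_sum,
      sum_ite_affine_eq_zero' e f]
    ring
  · simp [hg]

/-- Translating ux by an element of trace s shows that all the fibres have the same size. -/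
theorem card_mul_sum_ite_trace_mul_eq {u : L} (hu : u ≠ 0) (s : K) :
    (Fintype.card K : ℚ) * ∑ x : L, (if Algebra.trace K L (u * x) = s then 1 else 0) =
      Fintype.card L := by
  have h : ∀ s, ∑ x : L, (if Algebra.trace K L (u * x) = s then 1 else 0 : ℚ) =
      ∑ x : L, (if Algebra.trace K L x = 0 then 1 else 0) := by
    intro s
    obtain ⟨x₀, hx₀⟩ := Algebra.trace_surjective K L s
    rw [← ((Equiv.mulLeft₀ u hu).trans (Equiv.subRight x₀)).sum_comp
      fun x => if Algebra.trace K L x = 0 then 1 else 0]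
    refine sum_congr rfl fun x _ => ?_
    simp [hx₀, sub_eq_zero]
  calc _ = ∑ s : K, ∑ x : L, (if Algebra.trace K L (u * x) = s then 1 else 0 : ℚ) := by
        simp only [h, sum_const, card_univ, nsmul_eq_mul]
    _ = _ := by
        rw [sum_comm]
        simp

/-- The number of `x` with prescribed `Tr(x)` and with `Tr(a x) = 0`. -/
theorem card_sq_mul_sum_ite_trace_eq {a : L} (ha : a ∉ Set.range (algebraMap K L)) (b : K) :
    (Fintype.card K : ℚ) ^ 2 * ∑ x : L,
      (if Algebra.trace K L x = b ∧ Algebra.trace K L (a * x) = 0 then 1 else 0) =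
      Fintype.card L := by
  have hq : (1 : ℚ) < Fintype.card K := by exact_mod_cast Fintype.one_lt_card
  have h1 : ∑ x : L, ∑ z : K, ∑ w : K,
      (if 0 + (Algebra.trace K L x - b) * z + Algebra.trace K L (a * x) * w = 0 then 1 else 0 : ℚ)
        = Fintype.card K * Fintype.card L + (Fintype.card K ^ 2 - Fintype.card K) *
        ∑ x : L, (if Algebra.trace K L x = b ∧ Algebra.trace K L (a * x) = 0 then 1 else 0) := by
    simp only [sum_sum_ite_affine_eq_zero, if_true, sub_eq_zero (b := b), sum_add_distrib,
      mul_one, sum_const, card_univ, nsmul_eq_mul, ← sum_mul]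
    ring
  -- By independence of 1 and a, any (z, w) ≠ (0, 0) gives the trace against a nonzero element,
  -- whose fibres have #L/q elements; (0, 0) admits every x.
  have h2 : ∀ z w : K, ∑ x : L,
      (if 0 + (Algebra.trace K L x - b) * z + Algebra.trace K L (a * x) * w = 0 then 1 else 0 : ℚ)
        = Fintype.card L / Fintype.card K + (if z = 0 then 1 else 0) * (if w = 0 then 1 else 0) *
          (Fintype.card L - Fintype.card L / Fintype.card K) := by
    intro z w
    by_cases hzw : algebraMap K L z + algebraMap K L w * a = 0
    · obtain ⟨rfl, rfl⟩ := (algebraMap_add_mul_eq_zero_iff ha z w).1 hzw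
      simp
    · have h := card_mul_sum_ite_trace_mul_eq hzw (b * z)
      have h' : (if z = 0 then 1 else 0 : ℚ) * (if w = 0 then 1 else 0) = 0 := by
        rw [algebraMap_add_mul_eq_zero_iff ha] at hzw
        by_cases hz : z = 0
        · simp [show w ≠ 0 from fun hw => hzw ⟨hz, hw⟩]
        · simp [hz]
      rw [h', zero_mul, add_zero, eq_div_iff (by positivity), mul_comm, ← h]
      congr 1
      refine sum_congr rfl fun x _ => ?_
      congr 1
      rw [trace_mul_add_algebraMap, eq_iff_iff, ← sub_eq_zero (b := b * z)]
      constructor <;> intro h <;> linear_combination h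
  rw [sum_comm] at h1
  simp only [sum_comm (s := (univ : Finset L)), h2] at h1
  simp only [sum_add_distrib, ← sum_mul, ← mul_sum, sum_const, card_univ, nsmul_eq_mul,
    sum_ite_eq', mem_univ, if_true] at h1
  have hq' : (Fintype.card K : ℚ) - 1 ≠ 0 := by linarith
  rw [← mul_right_inj' hq']
  field_simp at h1
  linear_combination -h1

/-- Replacing x by x + z + wa cancels the quadratic terms in z and w, and leaves an equation affine
in (z, w) whose slopes vanish exactly when Tr(x) = b and Tr(ax) = 0. -/
theorem sum_sum_traceFormCount (h2 : ringChar K ≠ 2) (a : L) (b c : K) :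
    ∑ z : K, ∑ w : K, traceFormCount L (Algebra.trace K L 1 * z ^ 2 +
      2 * Algebra.trace K L a * z * w + Algebra.trace K L (a ^ 2) * w ^ 2 + 2 * b * z + c) =
      Fintype.card K * Fintype.card L + Fintype.card K ^ 2 * ∑ x : L,
        (if Algebra.trace K L x = b ∧ Algebra.trace K L (a * x) = 0 ∧
          Algebra.trace K L (x ^ 2) = c then 1 else 0) -
      Fintype.card K * ∑ x : L,
        (if Algebra.trace K L x = b ∧ Algebra.trace K L (a * x) = 0 then 1 else 0) := by
  have h20 : (2 : K) ≠ 0 := Ring.two_ne_zero h2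
  have h1 : ∀ z w : K, traceFormCount L (Algebra.trace K L 1 * z ^ 2 +
      2 * Algebra.trace K L a * z * w + Algebra.trace K L (a ^ 2) * w ^ 2 + 2 * b * z + c) =
      ∑ x : L, if (Algebra.trace K L (x ^ 2) - c) + (2 * (Algebra.trace K L x - b)) * z +
        (2 * Algebra.trace K L (a * x)) * w = 0 then 1 else 0 := by
    intro z w
    rw [traceFormCount,
      ← Equiv.sum_comp (Equiv.addRight (algebraMap K L z + algebraMap K L w * a))]
    refine sum_congr rfl fun x _ => ?_
    congr 1
    rw [Equiv.coe_addRight, trace_add_sq, trace_mul_add_algebraMap, trace_add_algebraMap_sq,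
      eq_iff_iff]
    constructor <;> intro h <;> linear_combination h
  have h3 : ∀ x : L, (Fintype.card K : ℚ) +
      (if 2 * (Algebra.trace K L x - b) = 0 ∧ 2 * Algebra.trace K L (a * x) = 0 then 1 else 0) *
        (Fintype.card K ^ 2 * (if Algebra.trace K L (x ^ 2) - c = 0 then 1 else 0) -
          Fintype.card K) =
      Fintype.card K + Fintype.card K ^ 2 *
        (if Algebra.trace K L x = b ∧ Algebra.trace K L (a * x) = 0 ∧
          Algebra.trace K L (x ^ 2) = c then 1 else 0) - Fintype.card K *
        (if Algebra.trace K L x = b ∧ Algebra.trace K L (a * x) = 0 then 1 else 0) := by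
    intro x
    simp only [mul_eq_zero, h20, false_or, sub_eq_zero]
    by_cases hb : Algebra.trace K L x = b <;> by_cases ha : Algebra.trace K L (a * x) = 0 <;>
      simp [hb, ha]
  simp only [h1, sum_comm (t := (univ : Finset L)), sum_sum_ite_affine_eq_zero, h3]
  simp only [sum_add_distrib, sum_sub_distrib, sum_const, card_univ, nsmul_eq_mul, ← mul_sum]
  ring

theorem card_cube_mul_sum_ite_trace_eq (h2 : ringChar K ≠ 2) {a : L}
    (ha : a ∉ Set.range (algebraMap K L)) (b c : K) :
    (Fintype.card K : ℚ) ^ 3 * ∑ x : L,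
        (if Algebra.trace K L x = b ∧ Algebra.trace K L (a * x) = 0 ∧
          Algebra.trace K L (x ^ 2) = c then 1 else 0) =
      Fintype.card K * (∑ z : K, ∑ w : K, traceFormCount L (Algebra.trace K L 1 * z ^ 2 +
        2 * Algebra.trace K L a * z * w + Algebra.trace K L (a ^ 2) * w ^ 2 + 2 * b * z + c)) -
      Fintype.card K ^ 2 * Fintype.card L + Fintype.card L := by
  have h := card_sq_mul_sum_ite_trace_eq ha b
  rw [sum_sum_traceFormCount h2]
  linear_combination h

theorem card_sq_mul_sum_ite_trace_sq_eq (h2 : ringChar K ≠ 2) (b c : K) :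
    (Fintype.card K : ℚ) ^ 2 * ∑ x : L,
        (if Algebra.trace K L x = b ∧ Algebra.trace K L (x ^ 2) = c then 1 else 0) =
      Fintype.card K * (∑ z : K,
        traceFormCount L (Algebra.trace K L 1 * z ^ 2 + 2 * b * z + c)) -
      Fintype.card K * Fintype.card L + Fintype.card L := by
  have h := card_mul_sum_ite_trace_mul_eq (one_ne_zero (α := L)) b
  -- With a = 0 the variable w is idle and the condition Tr(ax) = 0 is void.
  have h' := sum_sum_traceFormCount h2 (0 : L) b c
  have hq : (Fintype.card K : ℚ) ≠ 0 := by simp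
  simp only [one_mul] at h
  simp only [map_zero, mul_zero, zero_mul, add_zero, zero_pow two_ne_zero, true_and, and_true,
    sum_const, card_univ, nsmul_eq_mul, ← mul_sum] at h'
  linear_combination h - h'

end TraceCounts

/-! ### Point counts and character sums on the conics Mz² + 2Tzw + Aw² + 2z -/

section ConicCounts

open Finset

variable {K : Type*} [Field K] [Fintype K] [DecidableEq K]

local notation "χ" => ratQuadraticChar K

/-- Solving for w leaves a discriminant in z without constant term, to which
`sum_ratQuadraticChar_linear_mul` applies. -/
theorem sum_sum_ite_conic_of_ne_zero (h2 : ringChar K ≠ 2) (M T : K) {A : K} (hA : A ≠ 0) :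
    ∑ z : K, ∑ w : K, (if M * z ^ 2 + 2 * T * z * w + A * w ^ 2 + 2 * z = 0 then 1 else 0 : ℚ) =
      Fintype.card K - χ (T ^ 2 - M * A) := by
  have h20 : (2 : K) ≠ 0 := Ring.two_ne_zero h2
  have h : ∀ z w : K, M * z ^ 2 + 2 * T * z * w + A * w ^ 2 + 2 * z =
      A * w ^ 2 + 2 * (T * z) * w + (M * z ^ 2 + 2 * z) := fun z w => by ring
  have h' : ∀ z : K, (T * z) ^ 2 - A * (M * z ^ 2 + 2 * z) =
      (T ^ 2 - M * A) * z ^ 2 + (-2 * A) * z := fun z => by ring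
  simp only [h, sum_ite_quadratic_eq_zero h2 hA, h', sum_add_distrib]
  rw [sum_ratQuadraticChar_linear_mul h2 _ (by simp [h20, hA])]
  simp [sub_eq_add_neg]

/-- Each z ≠ 0 determines w, and z = 0 allows every w: (q - 1) + q points. -/
theorem sum_sum_ite_conic_of_eq_zero (h2 : ringChar K ≠ 2) (M : K) {T : K} (hT : T ≠ 0) :
    ∑ z : K, ∑ w : K, (if M * z ^ 2 + 2 * T * z * w + 2 * z = 0 then 1 else 0 : ℚ) =
      2 * Fintype.card K - 1 := by
  have h20 : (2 : K) ≠ 0 := Ring.two_ne_zero h2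
  have h : ∀ z w : K, M * z ^ 2 + 2 * T * z * w + 2 * z =
      (M * z ^ 2 + 2 * z) + (2 * T * z) * w := fun z w => by ring
  have h' : ∀ z : K, (if 2 * T * z = 0 then 1 else 0) *
      ((Fintype.card K : ℚ) * (if M * z ^ 2 + 2 * z = 0 then 1 else 0) - 1) =
      if z = 0 then (Fintype.card K : ℚ) - 1 else 0 := by
    intro z
    by_cases hz : z = 0 <;> simp [hz, h20, hT]
  simp only [h, sum_ite_affine_eq_zero', h', sum_add_distrib, sum_ite_eq', mem_univ, if_true]
  simp
  ring

theorem sum_ite_mul_sq_add_two_mul (h2 : ringChar K ≠ 2) (M b c : K) (h : M ≠ 0 ∨ b ≠ 0) :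
    ∑ z : K, (if M * z ^ 2 + 2 * b * z + c = 0 then 1 else 0 : ℚ) =
      if M = 0 then 1 else 1 + χ (b ^ 2 - M * c) := by
  have h20 : (2 : K) ≠ 0 := Ring.two_ne_zero h2
  split_ifs with hM
  · have hb : b ≠ 0 := h.resolve_left (not_not_intro hM)
    subst hM
    have h' := sum_ite_affine_eq_zero (mul_ne_zero h20 hb) c
    simp only [add_comm c] at h'
    simpa only [zero_mul, zero_add] using h'
  · exact sum_ite_quadratic_eq_zero h2 hM b c

theorem sum_sum_ratQuadraticChar_conic_of_ne_zero (h2 : ringChar K ≠ 2) (M T : K) {A : K}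
    (hA : A ≠ 0) :
    ∑ z : K, ∑ w : K, χ (M * z ^ 2 + 2 * T * z * w + A * w ^ 2 + 2 * z) =
      Fintype.card K * (if T ^ 2 - M * A = 0 then 0 else χ A) := by
  have h20 : (2 : K) ≠ 0 := Ring.two_ne_zero h2
  have h : ∀ z w : K, M * z ^ 2 + 2 * T * z * w + A * w ^ 2 + 2 * z =
      A * w ^ 2 + 2 * (T * z) * w + (M * z ^ 2 + 2 * z) := fun z w => by ring
  have h' : ∀ z : K, (T * z) ^ 2 - A * (M * z ^ 2 + 2 * z) =
      (T ^ 2 - M * A) * z ^ 2 + 2 * (-A) * z + 0 := fun z => by ring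
  simp only [h, sum_ratQuadraticChar_quadratic h2 hA, h', ← mul_sum, sum_sub_distrib]
  rw [sum_ite_mul_sq_add_two_mul h2 _ _ _ (Or.inr (neg_ne_zero.2 hA))]
  split_ifs with hE
  · simp
  · have hA1 : χ ((-A) ^ 2 - (T ^ 2 - M * A) * 0) = 1 := by
      rw [mul_zero, sub_zero, sq, map_mul, ratQuadraticChar_mul_self, if_neg (neg_ne_zero.2 hA)]
    rw [hA1]
    simp
    ring

theorem sum_sum_ratQuadraticChar_conic_of_eq_zero (h2 : ringChar K ≠ 2) (M : K) {T : K}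
    (hT : T ≠ 0) :
    ∑ z : K, ∑ w : K, χ (M * z ^ 2 + 2 * T * z * w + 2 * z) = 0 := by
  have h20 : (2 : K) ≠ 0 := Ring.two_ne_zero h2
  refine sum_eq_zero fun z _ => ?_
  by_cases hz : z = 0
  · simp [hz, ratQuadraticChar_zero]
  · have h : ∀ w : K, M * z ^ 2 + 2 * T * z * w + 2 * z =
      (M * z ^ 2 + 2 * z) + (2 * T * z) * w := fun w => by ring
    simp only [h]
    rw [sum_comp_affine (by simp [h20, hT, hz]) _ χ, sum_ratQuadraticChar h2]

/-- For M = 0 the argument is affine and nonconstant, so the sum is 0; the convention χ(0) = 0 lets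
one formula cover both cases. -/
theorem sum_ratQuadraticChar_mul_sq_add_two_mul (h2 : ringChar K ≠ 2) (M b c : K)
    (h : M ≠ 0 ∨ b ≠ 0) :
    ∑ z : K, χ (M * z ^ 2 + 2 * b * z + c) =
      χ M * (Fintype.card K * (if b ^ 2 - M * c = 0 then 1 else 0) - 1) := by
  have h20 : (2 : K) ≠ 0 := Ring.two_ne_zero h2
  by_cases hM : M = 0
  · have hb : b ≠ 0 := h.resolve_left (not_not_intro hM)
    subst hM
    have h' := sum_comp_affine (mul_ne_zero h20 hb) c χ
    simp only [add_comm c] at h'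
    simpa only [zero_mul, zero_add, ratQuadraticChar_zero, sum_ratQuadraticChar h2] using h'
  · exact sum_ratQuadraticChar_quadratic h2 hM b c

end ConicCounts

/-! ### The length of the code and the hyperplane sections of D -/

section SectionCounts

open Finset

variable {K : Type*} [Field K]

theorem card_eq_of_finrank [Fintype K] (L : Type*) [Field L] [Fintype L] [Algebra K L] {n : ℕ}
    (h : Module.finrank K L = n) : (Fintype.card L : ℚ) = (Fintype.card K : ℚ) ^ n := by
  rw [Module.card_eq_pow_finrank (K := K), h]
  push_cast
  rfl

variable [DecidableEq K] (L : Type*) [Field L] [Fintype L] [Algebra K L]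

/-- The number of `x` with `Tr(x) = b` and `Tr(x ^ 2) = c`. -/
noncomputable def tracePairCount (b c : K) : ℚ :=
  ∑ x : L, if Algebra.trace K L x = b ∧ Algebra.trace K L (x ^ 2) = c then 1 else 0

variable (K) in
/-- The number of `x` with `Tr(x) = 1`, `Tr(a x) = 0` and `Tr(x ^ 2) = 0`. -/
noncomputable def traceSectionCount {L : Type*} [Field L] [Fintype L] [Algebra K L] (a : L) : ℚ :=
  ∑ x : L, if Algebra.trace K L x = 1 ∧ Algebra.trace K L (a * x) = 0 ∧
    Algebra.trace K L (x ^ 2) = 0 then 1 else 0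

theorem traceSectionCount_algebraMap {L : Type*} [Field L] [Fintype L] [Algebra K L] {t : K}
    (ht : t ≠ 0) :
    traceSectionCount K (algebraMap K L t) = 0 := by
  refine sum_eq_zero fun x _ => if_neg ?_
  rintro ⟨h1, h2, -⟩
  rw [← Algebra.smul_def, map_smul, h1, smul_eq_mul, mul_one] at h2
  exact ht h2

variable [Fintype K]

local notation "χ" => ratQuadraticChar K
local notation "q" => (Fintype.card K : ℚ)

theorem tracePairCount_of_even (h2 : ringChar K ≠ 2) {k : ℕ}
    (hk : Module.finrank K L = 2 * k + 4) {b : K} (c : K)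
    (h : Algebra.trace K L 1 ≠ 0 ∨ b ≠ 0) :
    tracePairCount L b c = q ^ 2 * (q ^ k) ^ 2 - χ (-1) ^ k * q * q ^ k *
      (if Algebra.trace K L 1 = 0 then 0 else χ (b ^ 2 - Algebra.trace K L 1 * c)) := by
  have hq : q ≠ 0 := by simp
  have h1 := card_sq_mul_sum_ite_trace_sq_eq (L := L) h2 b c
  simp only [traceFormCount_of_even h2 hk, sum_add_distrib, ← mul_sum, sum_sub_distrib,
    sum_ite_mul_sq_add_two_mul h2 _ b c h, sum_const, card_univ, nsmul_eq_mul,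
    card_eq_of_finrank L hk] at h1
  have hi : (if Algebra.trace K L 1 = 0 then 1 else 1 + χ (b ^ 2 - Algebra.trace K L 1 * c)) =
      1 + (if Algebra.trace K L 1 = 0 then 0 else χ (b ^ 2 - Algebra.trace K L 1 * c)) := by
    split_ifs <;> simp
  rw [hi] at h1
  rw [← mul_right_inj' (pow_ne_zero 2 hq), tracePairCount, h1]
  ring

theorem tracePairCount_of_odd (h2 : ringChar K ≠ 2) {k : ℕ}
    (hk : Module.finrank K L = 2 * k + 3) {b : K} (c : K)
    (h : Algebra.trace K L 1 ≠ 0 ∨ b ≠ 0) :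
    tracePairCount L b c = q * (q ^ k) ^ 2 + χ (-1) ^ (k + 1) * q ^ k * χ (Algebra.trace K L 1) *
      (q * (if b ^ 2 - Algebra.trace K L 1 * c = 0 then 1 else 0) - 1) := by
  have hq : q ≠ 0 := by simp
  have h1 := card_sq_mul_sum_ite_trace_sq_eq (L := L) h2 b c
  simp only [traceFormCount_of_odd h2 hk, sum_add_distrib, ← mul_sum,
    sum_ratQuadraticChar_mul_sq_add_two_mul h2 _ b c h, sum_const, card_univ, nsmul_eq_mul,
    card_eq_of_finrank L hk] at h1
  rw [← mul_right_inj' (pow_ne_zero 2 hq), tracePairCount, h1]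
  ring

variable {L}

/-- The cases reflect the shape of Mz² + 2Tzw + Aw² + 2z: quadratic in w if A ≠ 0, linear in w if A
= 0 ≠ T, and free of w if A = T = 0, where M decides between one and two roots z. -/
theorem traceSectionCount_of_even (h2 : ringChar K ≠ 2) {k : ℕ}
    (hk : Module.finrank K L = 2 * k + 4) {a : L} (ha : a ∉ Set.range (algebraMap K L)) :
    traceSectionCount K a = q * (q ^ k) ^ 2 - χ (-1) ^ k * q ^ k *
      (if Algebra.trace K L (a ^ 2) = 0 then
        if Algebra.trace K L a = 0 then (if Algebra.trace K L 1 = 0 then 0 else q) else q - 1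
      else -χ (Algebra.trace K L a ^ 2 - Algebra.trace K L 1 * Algebra.trace K L (a ^ 2))) := by
  have hq : q ≠ 0 := by simp
  have h1 := card_cube_mul_sum_ite_trace_eq h2 ha 1 0
  simp only [traceFormCount_of_even h2 hk, sum_add_distrib, ← mul_sum, sum_sub_distrib,
    sum_const, card_univ, nsmul_eq_mul, card_eq_of_finrank L hk, mul_one, add_zero] at h1
  rw [← mul_right_inj' (pow_ne_zero 3 hq), traceSectionCount, h1]
  split_ifs with hA hT hM
  · have h3 := sum_ite_mul_sq_add_two_mul h2 (0 : K) 1 0 (Or.inr one_ne_zero)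
    simp only [mul_one, add_zero, if_true] at h3
    simp only [hA, hT, hM, mul_zero, zero_mul, add_zero, sum_const, card_univ, nsmul_eq_mul,
      ← mul_sum] at h3 ⊢
    rw [h3]
    ring
  · have h3 := sum_ite_mul_sq_add_two_mul h2 (Algebra.trace K L 1) 1 0 (Or.inr one_ne_zero)
    simp only [mul_one, add_zero, if_neg hM, mul_zero, sub_zero, one_pow, map_one] at h3
    simp only [hA, hT, mul_zero, zero_mul, add_zero, sum_const, card_univ, nsmul_eq_mul,
      ← mul_sum, h3]
    ring
  · simp only [hA, zero_mul, add_zero, sum_sum_ite_conic_of_eq_zero h2 _ hT]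
    ring
  · simp only [sum_sum_ite_conic_of_ne_zero h2 _ _ hA]
    ring

theorem traceSectionCount_of_odd (h2 : ringChar K ≠ 2) {k : ℕ}
    (hk : Module.finrank K L = 2 * k + 3) {a : L} (ha : a ∉ Set.range (algebraMap K L)) :
    traceSectionCount K a = (q ^ k) ^ 2 + χ (-1) ^ (k + 1) * q ^ k *
      (if Algebra.trace K L (a ^ 2) = 0 then
        if Algebra.trace K L a = 0 then -χ (Algebra.trace K L 1) else 0
      else if Algebra.trace K L a ^ 2 - Algebra.trace K L 1 * Algebra.trace K L (a ^ 2) = 0 then 0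
      else χ (Algebra.trace K L (a ^ 2))) := by
  have hq : q ≠ 0 := by simp
  have h1 := card_cube_mul_sum_ite_trace_eq h2 ha 1 0
  simp only [traceFormCount_of_odd h2 hk, sum_add_distrib, ← mul_sum,
    sum_const, card_univ, nsmul_eq_mul, card_eq_of_finrank L hk, mul_one, add_zero] at h1
  rw [← mul_right_inj' (pow_ne_zero 3 hq), traceSectionCount, h1]
  by_cases hA : Algebra.trace K L (a ^ 2) = 0
  · rw [if_pos hA]
    split_ifs with hT
    · have h3 := sum_ratQuadraticChar_mul_sq_add_two_mul h2 (Algebra.trace K L 1) 1 0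
        (Or.inr one_ne_zero)
      simp only [mul_one, add_zero, mul_zero, sub_zero, one_pow, one_ne_zero, if_false] at h3
      simp only [hA, hT, mul_zero, zero_mul, add_zero, sum_const, card_univ, nsmul_eq_mul,
        ← mul_sum, h3]
      ring
    · simp only [hA, zero_mul, add_zero, sum_sum_ratQuadraticChar_conic_of_eq_zero h2 _ hT]
      ring
  · simp only [sum_sum_ratQuadraticChar_conic_of_ne_zero h2 _ _ hA, if_neg hA]
    ring

end SectionCounts

/-! ### Summing functions of the weight over the field -/

section WeightSums

open Finset

variable {K : Type*} [Field K] [DecidableEq K]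

variable (K) in
/-- The weight of the codeword of `a`. -/
noncomputable def traceWeight {L : Type*} [Field L] [Fintype L] [Algebra K L] (a : L) : ℚ :=
  tracePairCount L (1 : K) 0 - traceSectionCount K a

theorem traceWeight_algebraMap {L : Type*} [Field L] [Fintype L] [Algebra K L] {t : K}
    (ht : t ≠ 0) :
    traceWeight K (algebraMap K L t) = tracePairCount L (1 : K) 0 := by
  rw [traceWeight, traceSectionCount_algebraMap ht, sub_zero]

variable [Fintype K]

local notation "χ" => ratQuadraticChar K
local notation "q" => (Fintype.card K : ℚ)

theorem sum_comp_trace_pair {L : Type*} [Field L] [Fintype L] [Algebra K L] (f : K → K → ℚ) :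
    ∑ a : L, f (Algebra.trace K L a) (Algebra.trace K L (a ^ 2)) =
      ∑ T : K, ∑ A : K, tracePairCount L T A * f T A := by
  have h : ∀ a : L, f (Algebra.trace K L a) (Algebra.trace K L (a ^ 2)) = ∑ T : K, ∑ A : K,
      (if Algebra.trace K L a = T ∧ Algebra.trace K L (a ^ 2) = A then 1 else 0) * f T A := by
    intro a
    simp only [ite_and, ite_mul, one_mul, zero_mul]
    simp
  simp only [h, tracePairCount, sum_mul, sum_comm (s := (univ : Finset L))]

variable {L : Type*} [Field L] [Fintype L] [Algebra K L]

/-- The formula W is summed over all of L, grouped by (Tr(a), Tr(a²)); the terms it wrongly assigns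
to t in K are subtracted and replaced by the true weights, 0 for t = 0 and #D otherwise. -/
theorem sum_comp_traceWeight (W : K → K → ℚ)
    (hW : ∀ a : L, a ∉ Set.range (algebraMap K L) →
      traceWeight K a = W (Algebra.trace K L a) (Algebra.trace K L (a ^ 2))) (g : ℚ → ℚ) :
    ∑ a : L, g (traceWeight K a) = g 0 + (q - 1) * g (tracePairCount L (1 : K) 0) +
      ∑ T : K, ∑ A : K, tracePairCount L T A * g (W T A) -
      ∑ t : K, g (W (t * Algebra.trace K L 1) (t ^ 2 * Algebra.trace K L 1)) := by
  have hinj := (algebraMap K L).injective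
  have htr : ∀ t : K, Algebra.trace K L (algebraMap K L t) = t * Algebra.trace K L 1 := by
    intro t
    rw [Algebra.algebraMap_eq_smul_one, map_smul, smul_eq_mul]
  have h1 : ∑ t : K, g (traceWeight K (algebraMap K L t)) =
      g 0 + (q - 1) * g (tracePairCount L (1 : K) 0) := by
    have h0 : traceWeight K (0 : L) = 0 := by
      simp [traceWeight, tracePairCount, traceSectionCount]
    rw [← add_sum_erase univ _ (mem_univ 0), map_zero, h0,
      sum_congr rfl fun t ht => by rw [traceWeight_algebraMap (ne_of_mem_erase ht)]]
    simp [card_erase_of_mem, Nat.cast_sub Fintype.card_pos]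
  -- The discrepancy between true weight and W is supported on the image of K.
  have h2 : ∑ a : L, (g (traceWeight K a) -
      g (W (Algebra.trace K L a) (Algebra.trace K L (a ^ 2)))) =
      ∑ t : K, (g (traceWeight K (algebraMap K L t)) -
        g (W (t * Algebra.trace K L 1) (t ^ 2 * Algebra.trace K L 1))) := by
    refine (Fintype.sum_of_injective _ hinj _ _ (fun a ha => ?_) fun t => ?_).symm
    · rw [hW a ha, sub_self]
    · rw [← map_pow, htr, htr]
  rw [sum_sub_distrib, sum_sub_distrib, h1, sum_comp_trace_pair fun T A => g (W T A)] at h2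
  linear_combination h2

theorem traceWeight_ne_zero (W : K → K → ℚ)
    (hW : ∀ a : L, a ∉ Set.range (algebraMap K L) →
      traceWeight K a = W (Algebra.trace K L a) (Algebra.trace K L (a ^ 2)))
    (hn : tracePairCount L (1 : K) 0 ≠ 0) (hW0 : ∀ T A, W T A ≠ 0) {a : L} (ha : a ≠ 0) :
    traceWeight K a ≠ 0 := by
  by_cases h : a ∈ Set.range (algebraMap K L)
  · obtain ⟨t, rfl⟩ := h
    rwa [traceWeight_algebraMap]
    rintro rfl
    exact ha (map_zero _)
  · rw [hW a h]
    exact hW0 _ _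

theorem sum_comp_ratQuadraticChar (h2 : ringChar K ≠ 2) (f : ℚ → ℚ) :
    ∑ a : K, f (χ a) = f 0 + (q - 1) / 2 * (f 1 + f (-1)) := by
  have h : ∀ a : K, f (χ a) = (f 1 + f (-1)) / 2 + (f 1 - f (-1)) / 2 * χ a +
      if a = 0 then f 0 - (f 1 + f (-1)) / 2 else 0 := by
    intro a
    split_ifs with ha
    · rw [ha, ratQuadraticChar_zero]
      ring
    · rcases ratQuadraticChar_eq_one_or_neg_one ha with h | h <;> rw [h] <;> ring
  simp only [h, sum_add_distrib, ← mul_sum, sum_ratQuadraticChar h2, sum_const, card_univ,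
    nsmul_eq_mul, sum_ite_eq', mem_univ, if_true]
  ring

/-- Needed when Tr(1) = 0 and T = 0, a case excluded from the formulas for the individual counts;
there the weight does not depend on A, so the total over A suffices. -/
theorem sum_tracePairCount (T : K) : q * ∑ A : K, tracePairCount L T A = Fintype.card L := by
  rw [← card_mul_sum_ite_trace_mul_eq (one_ne_zero (α := L)) T]
  congr 1
  simp only [tracePairCount, one_mul, ite_and]
  rw [sum_comm]
  simp

theorem sum_ite_eq_zero_const (u v : ℚ) :
    ∑ t : K, (if t = 0 then u else v) = u + (q - 1) * v := by
  have h : ∀ t : K, (if t = 0 then u else v) = v + if t = 0 then u - v else 0 := by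
    intro t
    split_ifs <;> ring
  simp only [h, sum_add_distrib, sum_const, card_univ, nsmul_eq_mul, sum_ite_eq', mem_univ, if_true]
  ring

end WeightSums

/-! ### From weights of field elements to the weight distribution of the code -/

section Code

open Finset

variable {p : ℕ} [Fact p.Prime] {F : Type*} [Field F] [Fintype F] [Algebra (ZMod p) F]

theorem card_definingSet : ((definingSet p F).card : ℚ) = tracePairCount F (1 : ZMod p) 0 := by
  rw [definingSet, tracePairCount, sum_boole]

theorem hammingNorm_traceCode (a : F) :
    (hammingNorm (fun x : definingSet p F => Algebra.trace (ZMod p) F (a * (x : F))) : ℚ) =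
      traceWeight (ZMod p) a := by
  rw [hammingNorm, ← sum_boole,
    sum_coe_sort (definingSet p F) fun x =>
      if Algebra.trace (ZMod p) F (a * x) ≠ 0 then (1 : ℚ) else 0,
    definingSet, sum_filter, traceWeight, tracePairCount, traceSectionCount, ← sum_sub_distrib]
  refine sum_congr rfl fun x _ => ?_
  by_cases h1 : Algebra.trace (ZMod p) F x = 1 <;>
    by_cases h2 : Algebra.trace (ZMod p) F (x ^ 2) = 0 <;>
    by_cases h3 : Algebra.trace (ZMod p) F (a * x) = 0 <;> simp [h1, h2, h3]

theorem sum_map_filter_eq (T : List (ℚ × ℚ)) (w : ℚ) :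
    ((T.filter fun row => row.1 = w).map fun row => row.2).sum =
      (T.map fun row => row.2 * if row.1 = w then 1 else 0).sum := by
  induction T with
  | nil => rfl
  | cons r T ih => by_cases h : r.1 = w <;> simp [h, ih]

/-- Nonvanishing weights make a ↦ (Tr(ax)) injective, so counting words amounts to counting a;
taking g to be the indicator of w gives the frequency. -/
theorem hasWeightDistribution_traceCode (T : List (ℚ × ℚ))
    (h0 : ∀ a : F, a ≠ 0 → traceWeight (ZMod p) a ≠ 0)
    (hT : ∀ g : ℚ → ℚ, ∑ a : F, g (traceWeight (ZMod p) a) =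
      (T.map fun row => row.2 * g row.1).sum) :
    HasWeightDistribution (traceCode p (definingSet p F)) T := by
  intro w
  let c : F →ₗ[ZMod p] (definingSet p F → ZMod p) := LinearMap.pi fun x : definingSet p F =>
    (Algebra.trace (ZMod p) F).comp (LinearMap.mulRight (ZMod p) (x : F))
  have hw : ∀ a, (hammingNorm (c a) : ℚ) = traceWeight (ZMod p) a := hammingNorm_traceCode
  have hinj : Function.Injective c := by
    rw [injective_iff_map_eq_zero]
    intro a ha
    by_contra hne
    refine h0 a hne ?_
    rw [← hw, ha]
    simp
  have himage : {v | v ∈ traceCode p (definingSet p F) ∧ (hammingNorm v : ℚ) = w} =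
      c '' {a | traceWeight (ZMod p) a = w} := by
    ext v
    constructor
    · rintro ⟨⟨a, rfl⟩, h⟩
      exact ⟨a, (hw a).symm.trans h, rfl⟩
    · rintro ⟨a, ha, rfl⟩
      exact ⟨⟨a, rfl⟩, (hw a).trans ha⟩
  rw [himage, Set.ncard_image_of_injective _ hinj, sum_map_filter_eq,
    ← hT fun v => if v = w then 1 else 0, sum_boole, Set.ncard_eq_toFinset_card']
  congr 2
  ext
  simp

end Code

/-! ### The four weight distributions over a general finite field of odd characteristic -/

section WeightDistributions

open Finset

variable {K : Type*} [Field K] [Fintype K]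
  {L : Type*} [Field L] [Fintype L] [Algebra K L]

local notation "χ" => ratQuadraticChar K
local notation "q" => (Fintype.card K : ℚ)

theorem three_le_card (h2 : ringChar K ≠ 2) : 3 ≤ q := by
  have h := FiniteField.odd_card_of_char_ne_two h2
  have h' : 1 < Fintype.card K := Fintype.one_lt_card
  exact_mod_cast show 3 ≤ Fintype.card K by omega

theorem one_le_card_pow (k : ℕ) : 1 ≤ q ^ k :=
  one_le_pow₀ (by exact_mod_cast Fintype.card_pos)

variable [DecidableEq K]

theorem ratQuadraticChar_neg_one_pow (k : ℕ) : χ (-1) ^ k = 1 ∨ χ (-1) ^ k = -1 := by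
  rcases ratQuadraticChar_eq_one_or_neg_one (neg_ne_zero.2 (one_ne_zero (α := K))) with h | h <;>
    rw [h]
  · exact Or.inl (one_pow k)
  · exact neg_one_pow_eq_or ℚ k

theorem ratQuadraticChar_sq {a : K} (ha : a ≠ 0) : χ (a ^ 2) = 1 := by
  rw [sq, map_mul, ratQuadraticChar_mul_self, if_neg ha]

theorem traceWeight_even_trace_one_eq_zero (h2 : ringChar K ≠ 2) {k : ℕ}
    (hk : Module.finrank K L = 2 * k + 4) (hM : Algebra.trace K L 1 = 0) {y s : ℚ}
    (hy : y = q ^ k) (hs : s = χ (-1) ^ k) :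
    (∀ a : L, a ≠ 0 → traceWeight K a ≠ 0) ∧ ∀ g : ℚ → ℚ, ∑ a : L, g (traceWeight K a) =
      g 0 + (q - 1) * g (q ^ 2 * y ^ 2) + (q ^ 3 * y ^ 2 - q) * g ((q - 1) * (q * y ^ 2)) +
        (q - 1) * (q ^ 2 * y ^ 2) * g ((q - 1) * (q * y ^ 2 + s * y)) +
        (q - 1) ^ 2 * (q ^ 2 * y ^ 2) * g ((q - 1) * (q * y ^ 2) - s * y) := by
  have hq := three_le_card h2
  have hy1 : 1 ≤ y := hy ▸ one_le_card_pow k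
  have hcount : ∀ (b : K) (c : K), b ≠ 0 → tracePairCount L b c = q ^ 2 * y ^ 2 := by
    intro b c hb
    rw [tracePairCount_of_even L h2 hk c (Or.inr hb), if_pos hM, ← hy, mul_zero, sub_zero]
  let W : K → K → ℚ := fun T A : K => if T = 0 then (q - 1) * (q * y ^ 2) else
        if A = 0 then (q - 1) * (q * y ^ 2 + s * y) else (q - 1) * (q * y ^ 2) - s * y
  have hW : ∀ a : L, a ∉ Set.range (algebraMap K L) →
      traceWeight K a = W (Algebra.trace K L a) (Algebra.trace K L (a ^ 2)) := by
    intro a ha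
    rw [traceWeight, hcount 1 0 one_ne_zero, traceSectionCount_of_even h2 hk ha, ← hy, ← hs, hM]
    dsimp only [W]
    by_cases hA : Algebra.trace K L (a ^ 2) = 0 <;> by_cases hT : Algebra.trace K L a = 0
    · simp only [hA, hT, if_true]
      ring
    · simp only [hA, hT, if_true, if_false]
      ring
    · simp only [hA, hT, if_true, if_false, zero_mul, zero_pow two_ne_zero, sub_self,
        ratQuadraticChar_zero]
      ring
    · simp only [hA, hT, if_false, zero_mul, sub_zero, ratQuadraticChar_sq hT]
      ring
  have hs1 := ratQuadraticChar_neg_one_pow (K := K) k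
  rw [← hs] at hs1
  refine ⟨fun a ha => traceWeight_ne_zero W hW ?_ (fun T A => ?_) ha, fun g => ?_⟩
  · rw [hcount 1 0 one_ne_zero]
    positivity
  · dsimp only [W]
    have h3 : 3 * 1 ≤ q * y := by gcongr
    split_ifs
    · have : 0 < (q - 1) * (q * y ^ 2) := mul_pos (by linarith) (by positivity)
      exact this.ne'
    · have : 0 < (q - 1) * (y * (q * y + s)) :=
        mul_pos (by linarith) (mul_pos (by linarith) (by rcases hs1 with h | h <;> linarith))
      convert this.ne' using 1
      ring
    · have : 0 < y * ((q - 1) * (q * y) - s) :=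
        mul_pos (by linarith) (by rcases hs1 with h | h <;> nlinarith)
      convert this.ne' using 1
      ring
  · rw [sum_comp_traceWeight W hW g, hcount 1 0 one_ne_zero]
    have hT : ∀ T : K, ∑ A : K, tracePairCount L T A * g (if T = 0 then (q - 1) * (q * y ^ 2) else
        if A = 0 then (q - 1) * (q * y ^ 2 + s * y) else (q - 1) * (q * y ^ 2) - s * y) =
        if T = 0 then q ^ 3 * y ^ 2 * g ((q - 1) * (q * y ^ 2)) else
          q ^ 2 * y ^ 2 * (g ((q - 1) * (q * y ^ 2 + s * y)) +
            (q - 1) * g ((q - 1) * (q * y ^ 2) - s * y)) := by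
      intro T
      split_ifs with hT
      · rw [← sum_mul]
        congr 1
        have h := sum_tracePairCount (L := L) T
        rw [card_eq_of_finrank (K := K) L hk] at h
        rw [← mul_right_inj' (show q ≠ 0 by simp), h, hy]
        ring
      · simp only [hcount T _ hT, ← mul_sum, apply_ite g, sum_ite_eq_zero_const]
    -- As Tr(1) = 0, all of K lies over (T, A) = (0, 0), so the correction takes q elements from the
    -- weight of T = 0.
    simp only [W, hT, sum_ite_eq_zero_const, hM, mul_zero, if_true, sum_const, card_univ,
      nsmul_eq_mul]
    ring

theorem traceWeight_odd_trace_one_eq_zero (h2 : ringChar K ≠ 2) {k : ℕ}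
    (hk : Module.finrank K L = 2 * k + 3) (hM : Algebra.trace K L 1 = 0) {y : ℚ}
    (hy : y = q ^ k) :
    (∀ a : L, a ≠ 0 → traceWeight K a ≠ 0) ∧ ∀ g : ℚ → ℚ, ∑ a : L, g (traceWeight K a) =
      g 0 + (q - 1) * g (q * y ^ 2) + (2 * (q ^ 2 * y ^ 2) - q * y ^ 2 - q) *
          g ((q - 1) * y ^ 2) +
        1 / 2 * (q - 1) ^ 2 * (q * y ^ 2) * g ((q - 1) * y ^ 2 - y) +
        1 / 2 * (q - 1) ^ 2 * (q * y ^ 2) * g ((q - 1) * y ^ 2 + y) := by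
  have hq := three_le_card h2
  have hy1 : 1 ≤ y := hy ▸ one_le_card_pow k
  have hcount : ∀ (b : K) (c : K), b ≠ 0 → tracePairCount L b c = q * y ^ 2 := by
    intro b c hb
    rw [tracePairCount_of_odd L h2 hk c (Or.inr hb), hM, ratQuadraticChar_zero, ← hy]
    ring
  obtain ⟨s, hs⟩ : ∃ s, s = χ (-1) ^ (k + 1) := ⟨_, rfl⟩
  have hs1 := ratQuadraticChar_neg_one_pow (K := K) (k + 1)
  rw [← hs] at hs1
  let W : K → K → ℚ := fun T A : K => if T = 0 then (q - 1) * y ^ 2 else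
        (q - 1) * y ^ 2 - s * y * χ A
  have hW : ∀ a : L, a ∉ Set.range (algebraMap K L) →
      traceWeight K a = W (Algebra.trace K L a) (Algebra.trace K L (a ^ 2)) := by
    intro a ha
    rw [traceWeight, hcount 1 0 one_ne_zero, traceSectionCount_of_odd h2 hk ha, ← hy, ← hs, hM]
    dsimp only [W]
    by_cases hA : Algebra.trace K L (a ^ 2) = 0 <;> by_cases hT : Algebra.trace K L a = 0 <;>
      simp only [hA, hT, if_true, if_false, zero_mul, zero_pow two_ne_zero, sub_self, sub_zero,
        ratQuadraticChar_zero, pow_eq_zero_iff two_ne_zero] <;> ring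
  refine ⟨fun a ha => traceWeight_ne_zero W hW ?_ (fun T A => ?_) ha, fun g => ?_⟩
  · rw [hcount 1 0 one_ne_zero]
    positivity
  · dsimp only [W]
    have hpos : ∀ u : ℚ, -1 ≤ u → 0 < (q - 1) * y ^ 2 + u * y := by
      intro u hu
      have : 0 < y * ((q - 1) * y + u) := mul_pos (by linarith) (by nlinarith)
      linarith
    split_ifs
    · have := hpos 0 (by norm_num)
      linarith
    · have := hpos (-(s * χ A)) (by
        by_cases hA : A = 0
        · simp [hA, ratQuadraticChar_zero]
        · rcases ratQuadraticChar_eq_one_or_neg_one hA with h | h <;> rcases hs1 with h' | h' <;>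
            rw [h, h'] <;> norm_num)
      linarith
  · rw [sum_comp_traceWeight W hW g, hcount 1 0 one_ne_zero]
    have hT : ∀ T : K, ∑ A : K, tracePairCount L T A * g (if T = 0 then (q - 1) * y ^ 2 else
        (q - 1) * y ^ 2 - s * y * χ A) =
        if T = 0 then q ^ 2 * y ^ 2 * g ((q - 1) * y ^ 2) else
          q * y ^ 2 * (g ((q - 1) * y ^ 2) + (q - 1) / 2 *
            (g ((q - 1) * y ^ 2 - y) + g ((q - 1) * y ^ 2 + y))) := by
      intro T
      split_ifs with hT
      · rw [← sum_mul]
        congr 1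
        have h := sum_tracePairCount (L := L) T
        rw [card_eq_of_finrank (K := K) L hk] at h
        rw [← mul_right_inj' (show q ≠ 0 by simp), h, hy]
        ring
      · simp only [hcount T _ hT, ← mul_sum,
          sum_comp_ratQuadraticChar h2 fun x => g ((q - 1) * y ^ 2 - s * y * x)]
        -- The sign s only exchanges the contributions of squares and nonsquares, which are equally
        -- many; hence it is absent from the result.
        rcases hs1 with h | h <;> rw [h] <;> ring_nf
    simp only [W, hT, sum_ite_eq_zero_const, hM, mul_zero, if_true, sum_const, card_univ,
      nsmul_eq_mul]
    ring

theorem traceWeight_even_trace_one_ne_zero (h2 : ringChar K ≠ 2) {k : ℕ}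
    (hk : Module.finrank K L = 2 * k + 4) (hM : Algebra.trace K L 1 ≠ 0) {y s n : ℚ}
    (hy : y = q ^ k) (hs : s = χ (-1) ^ k) (hn : n = q ^ 2 * y ^ 2 - s * (q * y)) :
    tracePairCount L (1 : K) 0 = n ∧
    (∀ a : L, a ≠ 0 → traceWeight K a ≠ 0) ∧ ∀ g : ℚ → ℚ, ∑ a : L, g (traceWeight K a) =
      g 0 + (q ^ 2 * y ^ 2 - 1) * g ((q - 1) * (q * y ^ 2)) +
        (q - 1) / 2 * (q ^ 3 * y ^ 2 + s * (q ^ 2 * y)) * g ((q - 1) * (q * y ^ 2 - s * y)) +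
        (q - 1) * g n + (q - 1) * (q ^ 2 * y ^ 2 - 1) * g (n - q * y ^ 2) +
        (q - 1) * n * g ((q - 1) * (q * y ^ 2) - s * y) +
        1 / 2 * (q - 1) * (q - 2) * n * g ((q - 1) * (q * y ^ 2) - (q + 1) * s * y) := by
  have hq := three_le_card h2
  have hy1 : 1 ≤ y := hy ▸ one_le_card_pow k
  have hcount : ∀ (b : K) (c : K), tracePairCount L b c =
      q ^ 2 * y ^ 2 - s * q * y * χ (b ^ 2 - Algebra.trace K L 1 * c) := by
    intro b c
    rw [tracePairCount_of_even L h2 hk c (Or.inl hM), if_neg hM, ← hy, ← hs]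
  have hcard : tracePairCount L (1 : K) 0 = n := by
    rw [hcount, mul_zero, sub_zero, one_pow, map_one, hn]
    ring
  let W : K → K → ℚ := fun T A : K => if A = 0 then
        if T = 0 then (q - 1) * (q * y ^ 2) else (q - 1) * (q * y ^ 2) - s * y else
          n - q * y ^ 2 - s * y * χ (T ^ 2 - Algebra.trace K L 1 * A)
  have hW : ∀ a : L, a ∉ Set.range (algebraMap K L) →
      traceWeight K a = W (Algebra.trace K L a) (Algebra.trace K L (a ^ 2)) := by
    intro a ha
    rw [traceWeight, hcard, traceSectionCount_of_even h2 hk ha, ← hy, ← hs, if_neg hM]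
    dsimp only [W]
    rw [hn]
    split_ifs <;> ring
  have hs1 := ratQuadraticChar_neg_one_pow (K := K) k
  rw [← hs] at hs1
  have h3 : 3 * 1 ≤ q * y := by gcongr
  refine ⟨hcard, fun a ha => traceWeight_ne_zero W hW ?_ (fun T A => ?_) ha, fun g => ?_⟩
  · rw [hcard, hn]
    have : 0 < q * y * (q * y - s) :=
      mul_pos (by positivity) (by rcases hs1 with h | h <;> linarith)
    convert this.ne' using 1
    ring
  · dsimp only [W]
    split_ifs
    · have : 0 < (q - 1) * (q * y ^ 2) := mul_pos (by linarith) (by positivity)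
      exact this.ne'
    · have : 0 < y * ((q - 1) * (q * y) - s) :=
        mul_pos (by linarith) (by rcases hs1 with h | h <;> nlinarith)
      convert this.ne' using 1
      ring
    · have : 0 < y * ((q - 1) * (q * y) - s * (q + χ (T ^ 2 - Algebra.trace K L 1 * A))) := by
        refine mul_pos (by linarith) ?_
        have h4 : (q - 1) * q ≤ (q - 1) * (q * y) := by
          gcongr
          · linarith
          · nlinarith
        have h5 : -1 ≤ χ (T ^ 2 - Algebra.trace K L 1 * A) ∧
            χ (T ^ 2 - Algebra.trace K L 1 * A) ≤ 1 := by
          by_cases hE : T ^ 2 - Algebra.trace K L 1 * A = 0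
          · simp [hE, ratQuadraticChar_zero]
          · rcases ratQuadraticChar_eq_one_or_neg_one hE with h | h <;> rw [h] <;> norm_num
        rcases hs1 with h | h <;> rw [h] <;> nlinarith
      rw [hn]
      convert this.ne' using 1
      ring
  · rw [sum_comp_traceWeight W hW g, hcard]
    -- G(χ(T² - MA)) is the summand for A ≠ 0. For fixed T the argument T² - MA runs over all of K,
    -- so only the term A = 0 has to be corrected.
    let G : ℚ → ℚ := fun x => (q ^ 2 * y ^ 2 - s * q * y * x) * g (n - q * y ^ 2 - s * y * x)
    have hT : ∀ T : K, ∑ A : K, tracePairCount L T A * g (if A = 0 then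
        if T = 0 then (q - 1) * (q * y ^ 2) else (q - 1) * (q * y ^ 2) - s * y else
          n - q * y ^ 2 - s * y * χ (T ^ 2 - Algebra.trace K L 1 * A)) =
        ∑ x : K, G (χ x) + if T = 0 then q ^ 2 * y ^ 2 * g ((q - 1) * (q * y ^ 2)) - G 0 else
          n * g ((q - 1) * (q * y ^ 2) - s * y) - G 1 := by
      intro T
      have h : ∀ A : K, tracePairCount L T A * g (if A = 0 then
        if T = 0 then (q - 1) * (q * y ^ 2) else (q - 1) * (q * y ^ 2) - s * y else
          n - q * y ^ 2 - s * y * χ (T ^ 2 - Algebra.trace K L 1 * A)) =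
          G (χ (T ^ 2 + -Algebra.trace K L 1 * A)) + if A = 0 then
            (if T = 0 then q ^ 2 * y ^ 2 * g ((q - 1) * (q * y ^ 2)) - G 0 else
          n * g ((q - 1) * (q * y ^ 2) - s * y) - G 1) else 0 := by
        intro A
        rw [hcount, neg_mul, ← sub_eq_add_neg]
        split_ifs with hA hT
        · simp only [hA, hT, mul_zero, sub_zero, zero_pow two_ne_zero, ratQuadraticChar_zero]
          ring
        · simp only [hA, mul_zero, sub_zero, ratQuadraticChar_sq hT, hn]
          ring
        · rw [add_zero]
      simp only [h, sum_add_distrib, sum_ite_eq', mem_univ, if_true]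
      rw [sum_comp_affine (neg_ne_zero.2 hM) _ fun x => G (χ x)]
    have hK : ∀ t : K, g (if t ^ 2 * Algebra.trace K L 1 = 0 then
        if t * Algebra.trace K L 1 = 0 then (q - 1) * (q * y ^ 2) else
          (q - 1) * (q * y ^ 2) - s * y else n - q * y ^ 2 - s * y *
          χ ((t * Algebra.trace K L 1) ^ 2 - Algebra.trace K L 1 * (t ^ 2 * Algebra.trace K L 1))) =
        if t = 0 then g ((q - 1) * (q * y ^ 2)) else g (n - q * y ^ 2) := by
      intro t
      -- Scalars satisfy T² = MA, so W gives them the middle value of the character, or the A = 0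
      -- value when t = 0.
      have hE : (t * Algebra.trace K L 1) ^ 2 -
          Algebra.trace K L 1 * (t ^ 2 * Algebra.trace K L 1) = 0 := by ring
      rw [hE, ratQuadraticChar_zero]
      by_cases ht : t = 0 <;> simp [ht, hM]
    simp only [W, hT, hK, sum_add_distrib, sum_ite_eq_zero_const, sum_const, card_univ,
      nsmul_eq_mul, sum_comp_ratQuadraticChar h2 G]
    have e1 : n - q * y ^ 2 - s * y * 0 = n - q * y ^ 2 := by ring
    have e2 : n - q * y ^ 2 - s * y * 1 = (q - 1) * (q * y ^ 2) - (q + 1) * s * y := by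
      rw [hn]
      ring
    have e3 : n - q * y ^ 2 - s * y * -1 = (q - 1) * (q * y ^ 2 - s * y) := by
      rw [hn]
      ring
    simp only [G, e1, e2, e3]
    rw [hn]
    ring

/-- The bound `hqy` keeps the weights n - y² ± y positive: such a weight is y((q - 1)y - h + u) with
h ≤ 1 and u ≥ -1. It fails only for q = 3 and y = 1. -/
theorem traceWeight_odd_trace_one_ne_zero (h2 : ringChar K ≠ 2) {k : ℕ}
    (hk : Module.finrank K L = 2 * k + 3) (hM : Algebra.trace K L 1 ≠ 0) {y s h n : ℚ}
    (hy : y = q ^ k) (hqy : 2 < (q - 1) * y) (hs : s = χ (-1) ^ (k + 1))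
    (hh : h = s * χ (Algebra.trace K L 1)) (hn : n = q * y ^ 2 - h * y) :
    tracePairCount L (1 : K) 0 = n ∧
    (∀ a : L, a ≠ 0 → traceWeight K a ≠ 0) ∧ ∀ g : ℚ → ℚ, ∑ a : L, g (traceWeight K a) =
      g 0 + (n + h * (q * y) - 1) * g ((q - 1) * y ^ 2) + (q - 1) * g n +
        (q - 1) * (2 * n + h * (q * y) - 1) * g (n - y ^ 2) +
        (if χ (Algebra.trace K L 1) = 1 then 1 / 2 * (q - 1) * (q - 2) * n else
          1 / 2 * (q - 1) * q * n) * g (n - y ^ 2 - s * y) +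
        (if χ (Algebra.trace K L 1) = 1 then 1 / 2 * (q - 1) * q * n else
          1 / 2 * (q - 1) * (q - 2) * n) * g (n - y ^ 2 + s * y) := by
  have hq := three_le_card h2
  have hy1 : 1 ≤ y := hy ▸ one_le_card_pow k
  obtain ⟨M, hMdef⟩ : ∃ M, M = Algebra.trace K L 1 := ⟨_, rfl⟩
  rw [← hMdef] at hM hh ⊢
  have hcount : ∀ (b : K) (c : K), tracePairCount L b c =
      n + if b ^ 2 - M * c = 0 then h * (q * y) else 0 := by
    intro b c
    rw [hMdef] at hM hh ⊢
    rw [tracePairCount_of_odd L h2 hk c (Or.inl hM), ← hy, ← hs, hn, hh]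
    split_ifs <;> ring
  have hcard : tracePairCount L (1 : K) 0 = n := by
    rw [hcount, if_neg (by simp), add_zero]
  have hs1 := ratQuadraticChar_neg_one_pow (K := K) (k + 1)
  rw [← hs] at hs1
  have hh1 : h ≤ 1 := by
    rcases hs1 with h' | h' <;> rcases ratQuadraticChar_eq_one_or_neg_one hM with h'' | h'' <;>
      rw [hh, h', h''] <;> norm_num
  let W : K → K → ℚ := fun T A : K => if T ^ 2 - M * A = 0 then
        if A = 0 then (q - 1) * y ^ 2 else n - y ^ 2 else n - y ^ 2 - s * y * χ A
  have hW : ∀ a : L, a ∉ Set.range (algebraMap K L) →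
      traceWeight K a = W (Algebra.trace K L a) (Algebra.trace K L (a ^ 2)) := by
    intro a ha
    rw [traceWeight, hcard, traceSectionCount_of_odd h2 hk ha, ← hy, ← hs, ← hMdef]
    dsimp only [W]
    by_cases hA : Algebra.trace K L (a ^ 2) = 0
    · by_cases hT : Algebra.trace K L a = 0
      · simp only [hA, hT, if_true, mul_zero, sub_zero, zero_pow two_ne_zero, hn, hh]
        ring
      · simp only [hA, hT, if_true, if_false, mul_zero, sub_zero, pow_eq_zero_iff two_ne_zero,
          ratQuadraticChar_zero]
        ring
    · simp only [hA, if_false]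
      split_ifs <;> ring
  refine ⟨hcard, fun a ha => traceWeight_ne_zero W hW ?_ (fun T A => ?_) ha, fun g => ?_⟩
  · rw [hcard, hn]
    have : 0 < y * (q * y - h) := mul_pos (by linarith) (by nlinarith)
    convert this.ne' using 1
    ring
  · dsimp only [W]
    have hpos : ∀ u : ℚ, -1 ≤ u → 0 < n - y ^ 2 + u * y := by
      intro u hu
      have : 0 < y * ((q - 1) * y - h + u) := mul_pos (by linarith) (by linarith)
      rw [hn]
      linarith
    split_ifs with hE hA
    · have : 0 < (q - 1) * y ^ 2 := mul_pos (by linarith) (by positivity)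
      exact this.ne'
    · have := hpos 0 (by norm_num)
      linarith
    · have := hpos (-(s * χ A)) (by
        by_cases hA : A = 0
        · simp [hA, ratQuadraticChar_zero]
        · rcases ratQuadraticChar_eq_one_or_neg_one hA with h | h <;> rcases hs1 with h' | h' <;>
            rw [h, h'] <;> norm_num)
      linarith
  · rw [sum_comp_traceWeight W hW g, hcard]
    -- H(χ(A)) is the generic summand. For each T the degenerate locus T² = MA is the single point A
    -- = T²/M, where χ(A) = χ(M) if T ≠ 0. Removing these points from the class of χ(M) makes the
    -- frequencies of the last two weights differ.
    let H : ℚ → ℚ := fun x => n * g (n - y ^ 2 - s * y * x)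
    have hT : ∀ T : K, ∑ A : K, tracePairCount L T A * g (if T ^ 2 - M * A = 0 then
        if A = 0 then (q - 1) * y ^ 2 else n - y ^ 2 else n - y ^ 2 - s * y * χ A) =
        ∑ x : K, H (χ x) + if T = 0 then (n + h * (q * y)) * g ((q - 1) * y ^ 2) - H 0 else
          (n + h * (q * y)) * g (n - y ^ 2) - H (χ M) := by
      intro T
      have hE : ∀ A : K, T ^ 2 - M * A = 0 ↔ A = T ^ 2 * M⁻¹ := by
        intro A
        rw [sub_eq_zero, ← div_eq_mul_inv, eq_div_iff hM, mul_comm M, eq_comm]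
      have h : ∀ A : K, tracePairCount L T A * g (if T ^ 2 - M * A = 0 then
        if A = 0 then (q - 1) * y ^ 2 else n - y ^ 2 else n - y ^ 2 - s * y * χ A) =
          H (χ A) + if A = T ^ 2 * M⁻¹ then (if T = 0 then
            (n + h * (q * y)) * g ((q - 1) * y ^ 2) - H 0 else
            (n + h * (q * y)) * g (n - y ^ 2) - H (χ M)) else 0 := by
        intro A
        rw [hcount]
        simp only [hE]
        by_cases hA : A = T ^ 2 * M⁻¹
        · rw [if_pos hA, if_pos hA, if_pos hA]
          by_cases hT : T = 0
          · have hA0 : A = 0 := by simp [hA, hT]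
            rw [if_pos hA0, if_pos hT, hA0, ratQuadraticChar_zero]
            ring
          · have hA0 : A ≠ 0 := by simp [hA, hT, hM]
            have hχ : χ A = χ M := by
              rw [hA, map_mul, ratQuadraticChar_sq hT, one_mul, ratQuadraticChar_inv]
            rw [if_neg hA0, if_neg hT, hχ]
            ring
        · rw [if_neg hA, if_neg hA, if_neg hA, add_zero, add_zero]
      simp only [h, sum_add_distrib, sum_ite_eq', mem_univ, if_true]
    have hK : ∀ t : K, g (if (t * M) ^ 2 - M * (t ^ 2 * M) = 0 then
        if t ^ 2 * M = 0 then (q - 1) * y ^ 2 else n - y ^ 2 else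
          n - y ^ 2 - s * y * χ (t ^ 2 * M)) =
        if t = 0 then g ((q - 1) * y ^ 2) else g (n - y ^ 2) := by
      intro t
      rw [if_pos (by ring)]
      by_cases ht : t = 0 <;> simp [ht, hM]
    rw [← hMdef]
    simp only [W, hT, hK, sum_add_distrib, sum_ite_eq_zero_const, sum_const, card_univ,
      nsmul_eq_mul, sum_comp_ratQuadraticChar h2 H]
    have e1 : n - y ^ 2 - s * y * 0 = n - y ^ 2 := by ring
    have e2 : n - y ^ 2 - s * y * 1 = n - y ^ 2 - s * y := by ring
    have e3 : n - y ^ 2 - s * y * -1 = n - y ^ 2 + s * y := by ring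
    rcases ratQuadraticChar_eq_one_or_neg_one hM with h' | h'
    · simp only [H, h', e1, e2, e3, if_true]
      ring
    · simp only [H, h', e1, e2, e3, show (-1 : ℚ) ≠ 1 by norm_num, if_false]
      ring

end WeightDistributions

/-! ### Specialisation to the prime field -/

theorem ratQuadraticChar_zmod_neg_one {p : ℕ} [Fact p.Prime] (hp : p ≠ 2) :
    ratQuadraticChar (ZMod p) (-1) = (-1) ^ ((p - 1) / 2) := by
  have h2 : ringChar (ZMod p) ≠ 2 := by rwa [ZMod.ringChar_zmod_n]
  have hodd := (Fact.out : p.Prime).eq_two_or_odd.resolve_left hp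
  rw [ratQuadraticChar_apply, quadraticChar_neg_one h2, ZMod.card,
    ZMod.χ₄_eq_neg_one_pow hodd, show p / 2 = (p - 1) / 2 by omega]
  push_cast
  rfl

theorem mainTheorem2 (p m : ℕ) [Fact p.Prime] (hp : p ≠ 2) (hm : 2 < m)
    (F : Type*) [Field F] [Fintype F] [Algebra (ZMod p) F] (hF : Fintype.card F = p ^ m) :
    let q : ℚ := p
    let η : ZMod p → ℚ := fun a => ((quadraticChar (ZMod p) a : ℤ) : ℚ)
    let mp : ZMod p := m
    let D : Finset F := definingSet p F
    let C : Submodule (ZMod p) (D → ZMod p) := traceCode p D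
    -- case 1: `m` even, `m ≡ 0 mod p`
    (Even m → mp = 0 →
      let ε : ℚ := (-1) ^ ((p - 1) * m / 4)
      HasWeightDistribution C
        [(0, 1),
         (q ^ (m - 2), q - 1),
         ((q - 1) * q ^ (m - 3), q ^ (m - 1) - q),
         ((q - 1) * (q ^ (m - 3) + ε * q ^ ((m - 4) / 2)), (q - 1) * q ^ (m - 2)),
         ((q - 1) * q ^ (m - 3) - ε * q ^ ((m - 4) / 2), (q - 1) ^ 2 * q ^ (m - 2))]) ∧
    -- case 2: `m` even, `m ≢ 0 mod p`
    (Even m → mp ≠ 0 →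
      let ε : ℚ := (-1) ^ ((p - 1) * m / 4)
      let n : ℚ := q ^ (m - 2) - ε * q ^ ((m - 2) / 2)
      (D.card : ℚ) = n ∧
      HasWeightDistribution C
        [(0, 1),
         ((q - 1) * q ^ (m - 3), q ^ (m - 2) - 1),
         ((q - 1) * (q ^ (m - 3) - ε * q ^ ((m - 4) / 2)),
            (q - 1) / 2 * (q ^ (m - 1) + ε * q ^ (m / 2))),
         (n, q - 1),
         (n - q ^ (m - 3), (q - 1) * (q ^ (m - 2) - 1)),
         ((q - 1) * q ^ (m - 3) - ε * q ^ ((m - 4) / 2), (q - 1) * n),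
         ((q - 1) * q ^ (m - 3) - (q + 1) * ε * q ^ ((m - 4) / 2),
            1 / 2 * (q - 1) * (q - 2) * n)]) ∧
    -- case 3: `m` odd, `m ≡ 0 mod p`
    (Odd m → mp = 0 →
      HasWeightDistribution C
        [(0, 1),
         (q ^ (m - 2), q - 1),
         ((q - 1) * q ^ (m - 3), 2 * q ^ (m - 1) - q ^ (m - 2) - q),
         ((q - 1) * q ^ (m - 3) - q ^ ((m - 3) / 2), 1 / 2 * (q - 1) ^ 2 * q ^ (m - 2)),
         ((q - 1) * q ^ (m - 3) + q ^ ((m - 3) / 2), 1 / 2 * (q - 1) ^ 2 * q ^ (m - 2))]) ∧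
    -- case 4: `m` odd, `m ≢ 0 mod p` (so that `η mp` is `1` or `-1`)
    (Odd m → mp ≠ 0 →
      let ε : ℚ := (-1) ^ ((p - 1) * (m + 1) / 4)
      let δ : ℚ := (-1) ^ ((p - 1) * (m - 1) / 4)
      let n : ℚ := q ^ (m - 2) - η (-mp) * ε * q ^ ((m - 3) / 2)
      let f₄ : ℚ := if η mp = 1 then 1 / 2 * (q - 1) * (q - 2) * n else 1 / 2 * (q - 1) * q * n
      let f₅ : ℚ := if η mp = 1 then 1 / 2 * (q - 1) * q * n else 1 / 2 * (q - 1) * (q - 2) * n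
      (D.card : ℚ) = n ∧
      HasWeightDistribution C
        [(0, 1),
         ((q - 1) * q ^ (m - 3), n + η (-mp) * ε * q ^ ((m - 1) / 2) - 1),
         (n, q - 1),
         (n - q ^ (m - 3), (q - 1) * (2 * n + η (-mp) * ε * q ^ ((m - 1) / 2) - 1)),
         (n - q ^ (m - 3) - δ * q ^ ((m - 3) / 2), f₄),
         (n - q ^ (m - 3) + δ * q ^ ((m - 3) / 2), f₅)]) := by
  intro q η mp D C
  have h2 : ringChar (ZMod p) ≠ 2 := by rwa [ZMod.ringChar_zmod_n]
  have hfin : Module.finrank (ZMod p) F = m := by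
    have h := Module.card_eq_pow_finrank (K := ZMod p) (V := F)
    rw [hF, ZMod.card] at h
    exact (Nat.pow_right_injective (Fact.out : p.Prime).two_le h).symm
  have htr : Algebra.trace (ZMod p) F 1 = mp := by
    have h := Algebra.trace_algebraMap (S := F) (1 : ZMod p)
    rwa [map_one, hfin, nsmul_one] at h
  have hq : (Fintype.card (ZMod p) : ℚ) = q := by rw [ZMod.card]
  obtain ⟨r, hr⟩ : ∃ r, p = 2 * r + 1 := by
    have hodd := (Fact.out : p.Prime).eq_two_or_odd.resolve_left hp
    exact ⟨p / 2, by omega⟩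
  have he : ratQuadraticChar (ZMod p) (-1) = (-1) ^ r := by
    rw [ratQuadraticChar_zmod_neg_one hp, show (p - 1) / 2 = r by omega]
  have he2 : (-1 : ℚ) ^ r * (-1) ^ r = 1 := by
    rw [← pow_add, Even.neg_one_pow ⟨r, rfl⟩]
  have hpow : ∀ j, (-1 : ℚ) ^ (r * j) = ((-1) ^ r) ^ j := fun j => pow_mul _ _ _
  -- With p = 2r + 1 the floor divisions in the exponents are exact, and each sign becomes a power
  -- of χ(-1) = (-1)^r; even powers of χ(-1) drop out.
  have heven : ∀ k, m = 2 * k + 4 →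
      (-1 : ℚ) ^ ((p - 1) * m / 4) = ratQuadraticChar (ZMod p) (-1) ^ k := by
    intro k hk
    have : (p - 1) * m / 4 = r * (k + 2) := by
      rw [hr, hk, Nat.add_sub_cancel, show 2 * r * (2 * k + 4) = 4 * (r * (k + 2)) by ring]
      omega
    rw [this, hpow, he, pow_add, sq, he2, mul_one]
  have hodd_add : ∀ k, m = 2 * k + 3 →
      (-1 : ℚ) ^ ((p - 1) * (m + 1) / 4) = ratQuadraticChar (ZMod p) (-1) ^ (k + 2) := by
    intro k hk
    have : (p - 1) * (m + 1) / 4 = r * (k + 2) := by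
      rw [hr, hk, Nat.add_sub_cancel,
        show 2 * r * (2 * k + 3 + 1) = 4 * (r * (k + 2)) by ring]
      omega
    rw [this, hpow, he]
  have hodd_sub : ∀ k, m = 2 * k + 3 →
      (-1 : ℚ) ^ ((p - 1) * (m - 1) / 4) = ratQuadraticChar (ZMod p) (-1) ^ (k + 1) := by
    intro k hk
    have : (p - 1) * (m - 1) / 4 = r * (k + 1) := by
      rw [hr, hk, Nat.add_sub_cancel, show 2 * k + 3 - 1 = 2 * (k + 1) by omega,
        show 2 * r * (2 * (k + 1)) = 4 * (r * (k + 1)) by ring]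
      omega
    rw [this, hpow, he]
  have exists_even : Even m → ∃ k, m = 2 * k + 4 := by
    rintro ⟨j, hj⟩
    exact ⟨j - 2, by omega⟩
  have exists_odd : Odd m → ∃ k, m = 2 * k + 3 := by
    rintro ⟨j, hj⟩
    exact ⟨j - 1, by omega⟩
  refine ⟨fun hm hmp => ?_, fun hm hmp => ?_, fun hm hmp => ?_, fun hm hmp => ?_⟩
  · obtain ⟨k, hk⟩ := exists_even hm
    intro ε
    have hε : ε = ratQuadraticChar (ZMod p) (-1) ^ k := heven k hk
    obtain ⟨h0, hg⟩ := traceWeight_even_trace_one_eq_zero (L := F) h2 (hfin.trans hk)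
      (htr.trans hmp) rfl hε
    rw [hq] at hg
    refine hasWeightDistribution_traceCode _ h0 fun g => (hg g).trans ?_
    clear_value ε q
    subst hk
    have e1 : 2 * k + 4 - 2 = 2 * k + 2 := by omega
    have e2 : 2 * k + 4 - 3 = 2 * k + 1 := by omega
    have e3 : 2 * k + 4 - 1 = 2 * k + 3 := by omega
    have e4 : (2 * k + 4 - 4) / 2 = k := by omega
    simp only [e1, e2, e3, e4, List.map_cons, List.map_nil, List.sum_cons, List.sum_nil]
    ring_nf
  · obtain ⟨k, hk⟩ := exists_even hm
    intro ε n
    have hε : ε = ratQuadraticChar (ZMod p) (-1) ^ k := heven k hk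
    obtain ⟨hn, h0, hg⟩ := traceWeight_even_trace_one_ne_zero (L := F) h2 (hfin.trans hk)
      (htr.trans_ne hmp) rfl hε rfl
    rw [hq] at hg hn
    have e1 : m - 2 = 2 * k + 2 := by omega
    have e2 : m - 3 = 2 * k + 1 := by omega
    have e3 : m - 1 = 2 * k + 3 := by omega
    have e4 : (m - 4) / 2 = k := by omega
    have e5 : (2 * k + 2) / 2 = k + 1 := by omega
    have e6 : m / 2 = k + 2 := by omega
    have hn' : n = q ^ 2 * (q ^ k) ^ 2 - ε * (q * q ^ k) := by
      simp only [n, e1, e5]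
      ring
    rw [← hn'] at hn hg
    refine ⟨card_definingSet.trans hn, hasWeightDistribution_traceCode _ h0 fun g =>
      (hg g).trans ?_⟩
    clear_value n ε q
    simp only [e1, e2, e3, e4, e6, List.map_cons, List.map_nil, List.sum_cons, List.sum_nil]
    ring_nf
  · obtain ⟨k, hk⟩ := exists_odd hm
    obtain ⟨h0, hg⟩ := traceWeight_odd_trace_one_eq_zero (L := F) h2 (hfin.trans hk)
      (htr.trans hmp) rfl
    rw [hq] at hg
    refine hasWeightDistribution_traceCode _ h0 fun g => (hg g).trans ?_
    clear_value q
    have e1 : m - 2 = 2 * k + 1 := by omega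
    have e2 : m - 3 = 2 * k := by omega
    have e3 : m - 1 = 2 * k + 2 := by omega
    have e4 : 2 * k / 2 = k := by omega
    simp only [e1, e2, e3, e4, List.map_cons, List.map_nil, List.sum_cons, List.sum_nil]
    ring_nf
  · obtain ⟨k, hk⟩ := exists_odd hm
    intro ε δ n f₄ f₅
    have hδ : δ = ratQuadraticChar (ZMod p) (-1) ^ (k + 1) := hodd_sub k hk
    have hε : ε = ratQuadraticChar (ZMod p) (-1) ^ (k + 2) := hodd_add k hk
    have hqy : 2 < ((Fintype.card (ZMod p) : ℚ) - 1) * (Fintype.card (ZMod p) : ℚ) ^ k := by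
      have h3 := three_le_card h2
      rcases Nat.eq_zero_or_pos k with rfl | hk0
      -- Here m = 3, so p = 3 would give m ≡ 0 mod p, contrary to the case assumption.
      · have hp3 : p ≠ 3 := by
          rintro rfl
          exact hmp (by simp only [mp, hk]; rfl)
        have : 3 < p := by
          have := (Fact.out : p.Prime).two_le
          omega
        have : (3 : ℚ) < Fintype.card (ZMod p) := by
          rw [ZMod.card]
          exact_mod_cast this
        rw [pow_zero]
        linarith
      · have : (Fintype.card (ZMod p) : ℚ) ≤ (Fintype.card (ZMod p) : ℚ) ^ k :=
          le_self_pow₀ (by linarith) hk0.ne'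
        nlinarith
    obtain ⟨hn, h0, hg⟩ := traceWeight_odd_trace_one_ne_zero (L := F) h2 (hfin.trans hk)
      (htr.trans_ne hmp) rfl hqy hδ rfl rfl
    rw [hq, htr] at hg hn
    have e1 : m - 2 = 2 * k + 1 := by omega
    have e2 : m - 3 = 2 * k := by omega
    have e4 : 2 * k / 2 = k := by omega
    have e5 : (m - 1) / 2 = k + 1 := by omega
    -- ε = χ(-1)δ, and the two factors χ(-1) cancel.
    have hh : η (-mp) * ε = δ * ratQuadraticChar (ZMod p) mp := by
      have : η (-mp) = ratQuadraticChar (ZMod p) (-1) * ratQuadraticChar (ZMod p) mp := by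
        rw [← map_mul, neg_one_mul]
        rfl
      rw [this, hε, hδ, he]
      linear_combination ((-1) ^ r) ^ (k + 1) * ratQuadraticChar (ZMod p) mp * he2
    have hn' : n = q * (q ^ k) ^ 2 - δ * ratQuadraticChar (ZMod p) mp * q ^ k := by
      simp only [n, e1, e2, e4, hh]
      ring
    rw [← hn', ← hh] at hg
    rw [← hn'] at hn
    refine ⟨card_definingSet.trans hn, hasWeightDistribution_traceCode _ h0 fun g =>
      (hg g).trans ?_⟩
    have hη : ratQuadraticChar (ZMod p) mp = η mp := rfl
    have hf₄ : (if η mp = 1 then 1 / 2 * (q - 1) * (q - 2) * n else 1 / 2 * (q - 1) * q * n) =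
      f₄ := rfl
    have hf₅ : (if η mp = 1 then 1 / 2 * (q - 1) * q * n else 1 / 2 * (q - 1) * (q - 2) * n) =
      f₅ := rfl
    rw [hη, hf₄, hf₅]
    clear_value f₄ f₅ n ε δ η q
    simp only [e2, e4, e5, List.map_cons, List.map_nil, List.sum_cons, List.sum_nil]
    ring_nf
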